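/- Let $0<a<b$, $A=I-a\partial_x^2$, $B=I-b\partial_x^2$, and consider the Benney--Luke system for $v_1=(q_1,r_1):\mathbb R\to H^1(\mathbb R;\mathbb R^2)$, $$\partial_t q_1=\partial_x r_1,\qquad \partial_t r_1=B^{-1}\bigl(A\,\partial_x q_1-r_1\partial_x q_1-2q_1\partial_x r_1\bigr),\qquad t\in\mathbb R,\qquad v_1(0)=v_0 .$$ By a solution we mean $v_1\in C(\mathbb R;H^1(\mathbb R;\mathbb R^2))\cap C^1(\mathbb R;L^2(\mathbb R;\mathbb R^2))$ satisfying the system in $L^2$ for every $t$. For $u=(q,r)$ put $\mathcal E(u)=\frac12\bigl(q^2+r^2+a(\partial_xq)^2+b(\partial_xr)^2\bigr)$, and for $\nu>0$ put $\chi_\nu(x)=1+\tanh(\nu x)$ and $\psi_\nu(x)=\operatorname{sech}(\nu x)$. For every constant $c_1>1$ there exist positive numbers $\nu_0,\delta_4,\mu$ (depending only on $a,b,c_1$) with the following property. For every $\nu\in(0,\nu_0)$, every $C^1$ function $\tilde x:\mathbb R\to\mathbb R$ with $\tilde x'(t)\ge c_1$ for all $t$, and every solution $v_1$ with $\|v_0\|_{H^1}<\delta_4$,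 we have for all $t\ge0$ $$\int_{\mathbb R}\chi_\nu(x-\tilde x(t))\,\mathcal E(v_1(t,x))\,dx+\mu\nu\int_0^t\!\!\int_{\mathbb R}\psi_\nu(x-\tilde x(s))^2\,\mathcal E(v_1(s,x))\,dx\,ds\le\int_{\mathbb R}\chi_\nu(x-\tilde x(0))\,\mathcal E(v_0(x))\,dx .$$ -/

import Mathlib

open MeasureTheory Set
open scoped ContDiff

noncomputable section

namespace BenneyLuke

/-- The real Hilbert space `L²(ℝ)`. -/
abbrev L2 : Type := Lp ℝ 2 (volume : Measure ℝ)

/-- Test functions: smooth and compactly supported. -/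
def IsTest (φ : ℝ → ℝ) : Prop := ContDiff ℝ ∞ φ ∧ HasCompactSupport φ

/-- `g` is the weak (distributional) derivative of `f`, both in `L²(ℝ)`. -/
def IsWeakDeriv (f g : L2) : Prop :=
  ∀ φ : ℝ → ℝ, IsTest φ → ∫ x, f x * deriv φ x = -∫ x, g x * φ x

lemma IsTest.deriv {φ : ℝ → ℝ} (h : IsTest φ) : IsTest (deriv φ) :=
  ⟨((contDiff_infty_iff_deriv (𝕜 := ℝ)).1 h.1).2, h.2.deriv⟩

lemma integrable_mul_test (f : L2) {φ : ℝ → ℝ} (h : IsTest φ) :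
    Integrable (fun x => f x * φ x) :=
  MemLp.integrable_mul (p := 2) (q := 2) (Lp.memLp f) (h.1.continuous.memLp_of_hasCompactSupport h.2)

lemma integral_add_mul (f g : L2) {φ : ℝ → ℝ} (h : IsTest φ) :
    ∫ x, (f + g : L2) x * φ x = (∫ x, f x * φ x) + ∫ x, g x * φ x := by
  rw [← integral_add (integrable_mul_test f h) (integrable_mul_test g h)]
  refine integral_congr_ae ?_
  filter_upwards [Lp.coeFn_add f g] with x hx
  rw [hx, Pi.add_apply, add_mul]

lemma integral_smul_mul (k : ℝ) (f : L2) (φ : ℝ → ℝ) :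
    ∫ x, (k • f : L2) x * φ x = k * ∫ x, f x * φ x := by
  rw [← integral_const_mul]
  refine integral_congr_ae ?_
  filter_upwards [Lp.coeFn_smul k f] with x hx
  rw [hx, Pi.smul_apply, smul_eq_mul, mul_assoc]

/-- The Sobolev space `H¹(ℝ)` of real-valued functions, realised as the space of pairs `(g, g')`
with `g ∈ L²` and weak derivative `g' ∈ L²`; it inherits from `L² × L²` the norm
`(‖g‖² + ‖g'‖²)^{1/2}`. -/
def H1 : Submodule ℝ (WithLp 2 (L2 × L2)) where
  carrier := {p | IsWeakDeriv p.fst p.snd}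
  zero_mem' := by
    intro φ hφ
    have h1 := integral_smul_mul 0 (0 : L2) (_root_.deriv φ)
    have h2 := integral_smul_mul 0 (0 : L2) φ
    simp only [smul_zero, zero_mul] at h1 h2
    simp only [WithLp.zero_fst, WithLp.zero_snd]
    rw [h1, h2, neg_zero]
  add_mem' := by
    intro p q hp hq φ hφ
    simp only [WithLp.add_fst, WithLp.add_snd]
    rw [integral_add_mul _ _ hφ.deriv, integral_add_mul _ _ hφ, hp φ hφ, hq φ hφ]
    ring
  smul_mem' := by
    intro k p hp φ hφ
    simp only [WithLp.smul_fst, WithLp.smul_snd]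
    rw [integral_smul_mul, integral_smul_mul, hp φ hφ]
    ring

/-- The state space `H¹(ℝ; ℝ²)` of pairs `u = (q, r)`, with the norm
`(‖q‖²_{H¹} + ‖r‖²_{H¹})^{1/2}`. -/
abbrev State : Type := WithLp 2 (H1 × H1)

/-- The component `q ∈ L²` of `u = (q, r)`. -/
def State.q (u : State) : L2 := (u.fst : WithLp 2 (L2 × L2)).fst

/-- The weak derivative `∂ₓq ∈ L²` of the component `q` of `u = (q, r)`. -/
def State.qx (u : State) : L2 := (u.fst : WithLp 2 (L2 × L2)).snd

/-- The component `r ∈ L²` of `u = (q, r)`. -/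
def State.r (u : State) : L2 := (u.snd : WithLp 2 (L2 × L2)).fst

/-- The weak derivative `∂ₓr ∈ L²` of the component `r` of `u = (q, r)`. -/
def State.rx (u : State) : L2 := (u.snd : WithLp 2 (L2 × L2)).snd

/-- The energy density `½ (q² + r² + a (∂ₓq)² + b (∂ₓr)²)` of `u = (q, r)`. -/
def energyDensity (a b : ℝ) (u : State) (x : ℝ) : ℝ :=
  (1 / 2) * ((u.q x) ^ 2 + (u.r x) ^ 2 + a * (u.qx x) ^ 2 + b * (u.rx x) ^ 2)

/-- `w = B⁻¹(A ∂ₓq - (r ∂ₓq + 2 q ∂ₓr))`, where `A = 1 - a ∂ₓ²` and `B = 1 - b ∂ₓ²`: that is,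
`w ∈ L²` and `B w = A ∂ₓq - (r ∂ₓq + 2 q ∂ₓr)` in the sense of distributions. For `b > 0` there
is at most one such `w`. -/
def IsSecondComponent (a b : ℝ) (u : State) (w : L2) : Prop :=
  ∀ φ : ℝ → ℝ, IsTest φ →
    ∫ x, w x * (φ x - b * deriv (deriv φ) x) =
      (∫ x, u.qx x * (φ x - a * deriv (deriv φ) x)) -
        ∫ x, (u.r x * u.qx x + 2 * u.q x * u.rx x) * φ x

/-- `v = (q, r) : ℝ → H¹(ℝ; ℝ²)` is a (global, energy-class) solution of the Benney-Luke system
`∂ₜq = ∂ₓr`, `∂ₜr = B⁻¹(A ∂ₓq - r ∂ₓq - 2 q ∂ₓr)`, that is of `∂ₜv = L v + f(v)`: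
`v` is continuous in time with values in `H¹`, it is differentiable in time with values in `L²`,
and the equation holds in `L²` at every time. -/
structure IsSolution (a b : ℝ) (v : ℝ → State) : Prop where
  continuous : Continuous v
  eq_q : ∀ t : ℝ, HasDerivAt (fun s => (v s).q) ((v t).rx) t
  eq_r : ∀ t : ℝ, ∃ w : L2, IsSecondComponent a b (v t) w ∧
    HasDerivAt (fun s => (v s).r) w t

/-- The smoothed Heaviside function `χ_ν(x) = 1 + tanh(νx)`. -/
def chi (ν x : ℝ) : ℝ := 1 + Real.tanh (ν * x)

/-- `ψ_ν(x) = sech(νx)`. -/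
def psi (ν x : ℝ) : ℝ := (Real.cosh (ν * x))⁻¹

/-- The weighted energy `∫ χ_ν(x - y) 𝓔(u)(x) dx`, with the weight centred at `y`. -/
def weightedEnergy (a b ν y : ℝ) (u : State) : ℝ :=
  ∫ x, chi ν (x - y) * energyDensity a b u x

/-- The localized energy `∫ ψ_ν(x - y)² 𝓔(u)(x) dx`, with the weight centred at `y`. -/
def localEnergy (a b ν y : ℝ) (u : State) : ℝ :=
  ∫ x, psi ν (x - y) ^ 2 * energyDensity a b u x

end BenneyLuke

end

noncomputable section

namespace BenneyLuke

open Filter Topology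
open scoped ENNReal

/-! ### Test functions and density in `H¹` -/

/-! The weighted energy obeys a balance law (`energyForm_balance`) in which every term carries the
derivative `θ'` of the weight. The equation for `∂ₜr` is nonlocal, so put `G = a ∂ₓq - b ∂ₜr`. It
solves `G - b G'' = b n - (b - a) ∂ₓq`, with `n` the nonlinearity, so `G` and its derivative `K` lie
in `H¹`; integration by parts then writes the linear flux as `q r + a ∂ₓq ∂ₓr - r K`
(`IsWeight.flux_identity`). The cubic term is exact too: `r n = ∂ₓ(q r²)` (`IsWeight.tri_nonlin`).

Up to a term in `n`, `q - K = (a/b) q + (1 - a/b) B⁻¹q`. For a weight with `|ρ'| ≤ 2νρ` and `ν`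
small, `B⁻¹` is almost a contraction of the weighted `L²` norm. As `a < b`, the linear flux is
therefore at most `(1 + σ)` times the local energy, and smallness in `L^∞` makes the nonlinear terms
cost another `σ` (`IsWeight.flux_le`). A weight moving at speed `c₁ ≥ 1 + 4σ` outruns this flux, and
the margin is the dissipation. Smallness persists in time because the weight `θ = 1` gives
conservation of the energy, which is comparable with the squared `H¹` norm.

Solutions are differentiable in time only in `L²`, so the energy cannot be differentiated directly.
Averages over `[s, s + η]` are differentiable in `H¹` and satisfy the linear system forced by the
averaged nonlinearity; the balance law passes to `η → 0` by continuity. -/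

lemma IsTest.memLp {φ : ℝ → ℝ} (h : IsTest φ) : MemLp φ 2 (volume : Measure ℝ) :=
  h.1.continuous.memLp_of_hasCompactSupport h.2

/-- The class in `L²` of a test function. -/
def IsTest.toL2 {φ : ℝ → ℝ} (h : IsTest φ) : L2 := h.memLp.toLp φ

lemma IsTest.coeFn_toL2 {φ : ℝ → ℝ} (h : IsTest φ) : h.toL2 =ᵐ[volume] φ :=
  h.memLp.coeFn_toLp

lemma IsTest.differentiable {φ : ℝ → ℝ} (h : IsTest φ) : Differentiable ℝ φ :=
  h.1.differentiable (by simp)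

lemma IsTest.comp_sub_left {φ : ℝ → ℝ} (h : IsTest φ) (c : ℝ) : IsTest fun x => φ (c - x) :=
  ⟨h.1.comp (contDiff_const.sub contDiff_id),
    h.2.comp_homeomorph (Homeomorph.subLeft c)⟩

lemma IsTest.smooth_mul {φ θ : ℝ → ℝ} (h : IsTest φ) (hθ : ContDiff ℝ ∞ θ) :
    IsTest fun x => θ x * φ x :=
  ⟨hθ.mul h.1, h.2.mul_left⟩

lemma IsTest.mul {φ θ : ℝ → ℝ} (h : IsTest φ) (hθ : IsTest θ) :
    IsTest fun x => θ x * φ x := h.smooth_mul hθ.1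

lemma inner_eq_integral (f g : L2) : inner ℝ f g = ∫ x, f x * g x := by
  rw [L2.inner_def]
  refine integral_congr_ae (.of_forall fun x => ?_)
  simp [mul_comm]

lemma inner_toL2 (f : L2) {φ : ℝ → ℝ} (h : IsTest φ) :
    inner ℝ f h.toL2 = ∫ x, f x * φ x := by
  rw [inner_eq_integral]
  refine integral_congr_ae ?_
  filter_upwards [h.coeFn_toL2] with x hx
  rw [hx]

/-- `f` must be a multiple of `exp (k x)`, which is unbounded at one end of the line. -/
lemma eq_zero_of_deriv_eq_mul_of_bounded {f : ℝ → ℝ} {k C : ℝ} (hk : k ≠ 0)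
    (hf : ∀ x, HasDerivAt f (k * f x) x) (hC : ∀ x, |f x| ≤ C) (x : ℝ) : f x = 0 := by
  have hd : ∀ y, HasDerivAt (fun y => f y * Real.exp (-(k * y))) 0 y := by
    intro y
    have h1 : HasDerivAt (fun y => Real.exp (-(k * y))) (Real.exp (-(k * y)) * (-(k * 1))) y :=
      (((hasDerivAt_id y).const_mul k).neg).exp
    exact ((hf y).mul h1).congr_deriv (by ring)
  have hconst : ∀ y, f y * Real.exp (-(k * y)) = f x * Real.exp (-(k * x)) := fun y =>
    is_const_of_deriv_eq_zero (fun y => (hd y).differentiableAt) (fun y => (hd y).deriv) y x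
  have hlim : Tendsto (fun s : ℝ => C * Real.exp (-s)) atTop (𝓝 0) := by
    simpa using (Real.tendsto_exp_neg_atTop_nhds_zero).const_mul C
  have hb : ∀ s : ℝ, |f x * Real.exp (-(k * x))| ≤ C * Real.exp (-s) := by
    intro s
    -- Evaluating at `s / k` selects the end where the exponential grows, whatever the sign of `k`.
    rw [← hconst (s / k), abs_mul, Real.abs_exp, mul_div_cancel₀ _ hk]
    exact mul_le_mul_of_nonneg_right (hC _) (Real.exp_pos _).le
  have h0 : |f x * Real.exp (-(k * x))| ≤ 0 := ge_of_tendsto' hlim hb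
  have h1 := abs_nonpos_iff.1 h0
  exact (mul_eq_zero.1 h1).resolve_right (Real.exp_pos _).ne'

/-- A distributional solution `G ∈ L²` of `G - b G'' = 0` vanishes. -/
lemma eq_zero_of_helmholtz {b : ℝ} (hb : 0 < b) (G : L2)
    (hG : ∀ φ, IsTest φ → ∫ x, G x * (φ x - b * deriv (deriv φ) x) = 0) : G = 0 := by
  have hloc : LocallyIntegrable G := (Lp.memLp G).locallyIntegrable (by norm_num)
  -- Convolution with a test function turns the distributional equation into the classical `u = b
  -- u''`, with `u` and `u'` bounded.
  set u : (ℝ → ℝ) → ℝ → ℝ := fun φ x => ∫ t, G t * φ (x - t) with hu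
  have hder : ∀ φ, IsTest φ → ∀ x, HasDerivAt (u φ) (u (deriv φ) x) x := by
    intro φ hφ x
    exact hφ.2.hasDerivAt_convolution_right (ContinuousLinearMap.mul ℝ ℝ) hloc
      (hφ.1.of_le (by simp)) x
  have hbd : ∀ φ, IsTest φ → ∃ C, ∀ x, |u φ x| ≤ C := by
    intro φ hφ
    refine ⟨‖G‖ * ‖hφ.toL2‖, fun x => ?_⟩
    have h1 : u φ x = inner ℝ G (hφ.comp_sub_left x).toL2 := (inner_toL2 _ _).symm
    have h2 : ‖(hφ.comp_sub_left x).toL2‖ = ‖hφ.toL2‖ := by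
      simp only [IsTest.toL2, Lp.norm_toLp]
      congr 1
      exact eLpNorm_comp_measurePreserving (g := φ) (hφ.1.continuous.aestronglyMeasurable)
        (Measure.measurePreserving_sub_left volume x)
    rw [h1, ← h2]
    exact abs_real_inner_le_norm _ _
  have heq : ∀ φ, IsTest φ → ∀ x, u φ x = b * u (deriv (deriv φ)) x := by
    intro φ hφ x
    have hd : deriv (fun t => φ (x - t)) = fun t => -deriv φ (x - t) := by
      ext t; exact deriv_comp_const_sub φ x t
    have hd2 : deriv (deriv (fun t => φ (x - t))) = fun t => deriv (deriv φ) (x - t) := by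
      ext t
      rw [hd, deriv.fun_neg, deriv_comp_const_sub (deriv φ) x t, neg_neg]
    have h := hG _ (hφ.comp_sub_left x)
    rw [hd2] at h
    have i1 := integrable_mul_test G (hφ.comp_sub_left x)
    have i2 := integrable_mul_test G (hφ.deriv.deriv.comp_sub_left x)
    have : ∫ t, G t * (φ (x - t) - b * deriv (deriv φ) (x - t))
        = u φ x - b * u (deriv (deriv φ)) x := by
      rw [hu]
      simp only
      rw [← integral_const_mul, ← integral_sub i1 (i2.const_mul b)]
      congr 1; ext t; ring
    linarith
  have hz : ∀ φ, IsTest φ → ∀ x, u φ x = 0 := by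
    intro φ hφ x
    set k := (Real.sqrt b)⁻¹ with hk
    have hkpos : 0 < k := by positivity
    have hkb : k ^ 2 * b = 1 := by
      rw [hk, inv_pow, Real.sq_sqrt hb.le, inv_mul_cancel₀ hb.ne']
    have h2 : ∀ x, u (deriv (deriv φ)) x = k ^ 2 * u φ x := by
      intro x
      rw [heq φ hφ x, ← mul_assoc, hkb, one_mul]
    obtain ⟨C0, hC0⟩ := hbd φ hφ
    obtain ⟨C1, hC1⟩ := hbd _ hφ.deriv
    -- With `κ² = 1/b`, the function `u' + κ u` satisfies `f' = κ f` and is bounded, hence vanishes.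
    -- The two signs of `κ` together give `u = 0`.
    have key : ∀ κ : ℝ, κ ^ 2 = k ^ 2 → κ ≠ 0 → u (deriv φ) x + κ * u φ x = 0 := by
      intro κ hκ hκ0
      refine eq_zero_of_deriv_eq_mul_of_bounded (f := fun x => u (deriv φ) x + κ * u φ x)
        (C := C1 + |κ| * C0) hκ0 (fun y => ?_) (fun y => ?_) x
      · refine ((hder _ hφ.deriv y).add ((hder _ hφ y).const_mul κ)).congr_deriv ?_
        rw [h2, ← hκ]; ring
      · refine (abs_add_le _ _).trans (add_le_add (hC1 y) ?_)
        rw [abs_mul]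
        exact mul_le_mul_of_nonneg_left (hC0 y) (abs_nonneg _)
    have e1 := key k rfl hkpos.ne'
    have e2 := key (-k) (by ring) (neg_ne_zero.2 hkpos.ne')
    have : k * u φ x = 0 := by linarith
    exact (mul_eq_zero.1 this).resolve_left hkpos.ne'
  have hae : ∀ᵐ x, G x = 0 := by
    refine ae_eq_zero_of_integral_contDiff_smul_eq_zero hloc fun g hg hgs => ?_
    have hgt : IsTest g := ⟨hg, hgs⟩
    have := hz _ (hgt.comp_sub_left 0) 0
    simp only [hu, zero_sub, neg_neg] at this
    rw [← this]
    congr 1; ext t; simp [mul_comm]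
  exact (Lp.eq_zero_iff_ae_eq_zero).2 hae

lemma isWeakDeriv_iff_inner {f g : L2} :
    IsWeakDeriv f g ↔ ∀ φ (h : IsTest φ), inner ℝ f h.deriv.toL2 = -inner ℝ g h.toL2 := by
  simp only [IsWeakDeriv, inner_toL2]

lemma isClosed_H1 : IsClosed (H1 : Set (WithLp 2 (L2 × L2))) := by
  have : (H1 : Set (WithLp 2 (L2 × L2))) = ⋂ φ : {φ : ℝ → ℝ // IsTest φ},
      {p | inner ℝ p.fst φ.2.deriv.toL2 = -inner ℝ p.snd φ.2.toL2} := by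
    ext p
    simp only [mem_iInter, mem_ofPred_eq, Subtype.forall]
    exact isWeakDeriv_iff_inner
  rw [this]
  refine isClosed_iInter fun φ => isClosed_eq ?_ ?_ <;> fun_prop

instance : CompleteSpace H1 := isClosed_H1.completeSpace_coe

/-- The pair `(f, g)` as an element of `H¹`, where `g` is the weak derivative of `f`. -/
def IsWeakDeriv.toH1 {f g : L2} (h : IsWeakDeriv f g) : H1 := ⟨WithLp.toLp 2 (f, g), h⟩

/-- The underlying `L²` function, as a continuous linear map on `H¹`. -/
def val : H1 →L[ℝ] L2 := (WithLp.fstL 2 ℝ L2 L2).comp H1.subtypeL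

/-- The weak derivative, as a continuous linear map on `H¹`. -/
def der : H1 →L[ℝ] L2 := (WithLp.sndL 2 ℝ L2 L2).comp H1.subtypeL

@[simp] lemma val_toH1 {f g : L2} (h : IsWeakDeriv f g) : val h.toH1 = f := rfl
@[simp] lemma der_toH1 {f g : L2} (h : IsWeakDeriv f g) : der h.toH1 = g := rfl

lemma isWeakDeriv (f : H1) : IsWeakDeriv (val f) (der f) := f.2

lemma inner_H1 (f g : H1) :
    inner ℝ f g = inner ℝ (val f) (val g) + inner ℝ (der f) (der g) := by
  rw [Submodule.coe_inner, WithLp.prod_inner_apply]; rfl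

lemma norm_sq_H1 (f : H1) : ‖f‖ ^ 2 = ‖val f‖ ^ 2 + ‖der f‖ ^ 2 := by
  simp only [← real_inner_self_eq_norm_sq, inner_H1]

lemma ext_H1 {f g : H1} (h : val f = val g) (h' : der f = der g) : f = g := by
  have : ‖f - g‖ ^ 2 = 0 := by rw [norm_sq_H1]; simp [h, h']
  simpa [sub_eq_zero] using this

lemma IsTest.isWeakDeriv {φ : ℝ → ℝ} (h : IsTest φ) :
    IsWeakDeriv h.toL2 h.deriv.toL2 := by
  intro θ hθ
  have e1 : ∫ x, h.toL2 x * _root_.deriv θ x = ∫ x, φ x * _root_.deriv θ x :=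
    integral_congr_ae (by filter_upwards [h.coeFn_toL2] with x hx; rw [hx])
  have e2 : ∫ x, h.deriv.toL2 x * θ x = ∫ x, _root_.deriv φ x * θ x :=
    integral_congr_ae (by filter_upwards [h.deriv.coeFn_toL2] with x hx; rw [hx])
  rw [e1, e2]
  refine integral_mul_deriv_eq_deriv_mul_of_integrable
    (fun x _ => (h.differentiable x).hasDerivAt) (fun x _ => (hθ.differentiable x).hasDerivAt)
    ?_ ?_ ?_
  · exact (hθ.deriv.mul h).1.continuous.integrable_of_hasCompactSupport (hθ.deriv.mul h).2
  · exact (hθ.mul h.deriv).1.continuous.integrable_of_hasCompactSupport (hθ.mul h.deriv).2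
  · exact (hθ.mul h).1.continuous.integrable_of_hasCompactSupport (hθ.mul h).2

/-- A test function as an element of `H¹`. -/
def IsTest.toH1 {φ : ℝ → ℝ} (h : IsTest φ) : H1 := h.isWeakDeriv.toH1

@[simp] lemma IsTest.val_toH1 {φ : ℝ → ℝ} (h : IsTest φ) : val h.toH1 = h.toL2 := rfl
@[simp] lemma IsTest.der_toH1 {φ : ℝ → ℝ} (h : IsTest φ) : der h.toH1 = h.deriv.toL2 := rfl

/-- The subspace of test functions in `H¹`. -/
def testSubmodule : Submodule ℝ H1 where
  carrier := {f | ∃ φ, ∃ h : IsTest φ, f = h.toH1}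
  zero_mem' := by
    have h : IsTest 0 := ⟨contDiff_const, HasCompactSupport.zero⟩
    refine ⟨0, h, ext_H1 ?_ ?_⟩
    · ext1
      filter_upwards [h.coeFn_toL2, Lp.coeFn_zero ℝ 2 volume] with x h1 h2
      rw [IsTest.val_toH1, h1, map_zero, h2]
    · ext1
      filter_upwards [h.deriv.coeFn_toL2, Lp.coeFn_zero ℝ 2 volume] with x h1 h2
      rw [IsTest.der_toH1, h1, map_zero, h2, deriv_zero, Pi.zero_apply]
  add_mem' := by
    rintro _ _ ⟨φ, h, rfl⟩ ⟨θ, g, rfl⟩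
    have k : IsTest (φ + θ) := ⟨h.1.add g.1, h.2.add g.2⟩
    refine ⟨_, k, ext_H1 ?_ ?_⟩
    · ext1
      filter_upwards [h.coeFn_toL2, g.coeFn_toL2, k.coeFn_toL2,
        Lp.coeFn_add h.toL2 g.toL2] with x h1 h2 h3 h4
      rw [IsTest.val_toH1, h3, map_add, IsTest.val_toH1, IsTest.val_toH1, h4, Pi.add_apply,
        Pi.add_apply, h1, h2]
    · ext1
      filter_upwards [h.deriv.coeFn_toL2, g.deriv.coeFn_toL2, k.deriv.coeFn_toL2,
        Lp.coeFn_add h.deriv.toL2 g.deriv.toL2] with x h1 h2 h3 h4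
      rw [IsTest.der_toH1, h3, map_add, IsTest.der_toH1, IsTest.der_toH1, h4, Pi.add_apply, h1, h2,
        deriv_add (h.differentiable x) (g.differentiable x)]
  smul_mem' := by
    rintro c _ ⟨φ, h, rfl⟩
    have k : IsTest (c • φ) := ⟨h.1.const_smul c, h.2.mono (Function.support_const_smul_subset c φ)⟩
    refine ⟨_, k, ext_H1 ?_ ?_⟩
    · ext1
      filter_upwards [h.coeFn_toL2, k.coeFn_toL2, Lp.coeFn_smul c h.toL2] with x h1 h3 h4
      rw [IsTest.val_toH1, h3, map_smul, IsTest.val_toH1, h4, Pi.smul_apply, Pi.smul_apply, h1]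
    · ext1
      filter_upwards [h.deriv.coeFn_toL2, k.deriv.coeFn_toL2,
        Lp.coeFn_smul c h.deriv.toL2] with x h1 h3 h4
      rw [IsTest.der_toH1, h3, map_smul, IsTest.der_toH1, h4, Pi.smul_apply, h1,
        deriv_const_smul c (h.differentiable x)]

/-- An element orthogonal to all test functions solves `f - f'' = 0` in the sense of distributions,
so it vanishes by `eq_zero_of_helmholtz` with `b = 1`. -/
lemma dense_testSubmodule : Dense (testSubmodule : Set H1) := by
  rw [Submodule.dense_iff_topologicalClosure_eq_top,
    Submodule.topologicalClosure_eq_top_iff, Submodule.eq_bot_iff]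
  intro f hf
  rw [Submodule.mem_orthogonal] at hf
  have h0 : val f = 0 := by
    refine eq_zero_of_helmholtz one_pos _ fun φ hφ => ?_
    have h1 := hf _ ⟨φ, hφ, rfl⟩
    rw [real_inner_comm, inner_H1, IsTest.val_toH1, IsTest.der_toH1, inner_toL2, inner_toL2] at h1
    have h2 := isWeakDeriv f _ hφ.deriv
    simp only [one_mul, mul_sub]
    rw [integral_sub (integrable_mul_test _ hφ) (integrable_mul_test _ hφ.deriv.deriv)]
    linarith
  have h1 : der f = 0 := by
    refine (Lp.eq_zero_iff_ae_eq_zero).2 ?_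
    refine ae_eq_zero_of_integral_contDiff_smul_eq_zero
      ((Lp.memLp _).locallyIntegrable (by norm_num)) fun g hg hgs => ?_
    have hgt : IsTest g := ⟨hg, hgs⟩
    have h3 := isWeakDeriv_iff_inner.1 (isWeakDeriv f) g hgt
    rw [h0, inner_zero_left, inner_toL2] at h3
    simp only [smul_eq_mul, mul_comm (g _)]
    linarith
  exact ext_H1 (by simpa using h0) (by simpa using h1)

/-- A closed property of `H¹` functions holds if it holds for test functions. -/
lemma H1_induction {P : H1 → Prop} (hP : IsClosed {f | P f})
    (h : ∀ φ (hφ : IsTest φ), P hφ.toH1) (f : H1) : P f := by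
  have : f ∈ closure (testSubmodule : Set H1) := dense_testSubmodule f
  refine closure_minimal ?_ hP this
  rintro _ ⟨φ, hφ, rfl⟩
  exact h φ hφ

/-! ### Multiplication by bounded functions -/

/-- The space `L^∞(ℝ)`. -/
abbrev Linf : Type := Lp ℝ ∞ (volume : Measure ℝ)

/-- Multiplication `L^∞ × L² → L²`. -/
def mulL : Linf →L[ℝ] L2 →L[ℝ] L2 :=
  (ContinuousLinearMap.mul ℝ ℝ).holderL (volume : Measure ℝ) ∞ 2 2

lemma coeFn_mulL (m : Linf) (f : L2) : mulL m f =ᵐ[volume] fun x => m x * f x :=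
  (ContinuousLinearMap.mul ℝ ℝ).coeFn_holder m f

/-- The weighted pairing `∫ m f g`. -/
def tri (m : Linf) (f g : L2) : ℝ := inner ℝ (mulL m f) g

lemma tri_eq_integral (m : Linf) (f g : L2) : tri m f g = ∫ x, m x * f x * g x := by
  rw [tri, inner_eq_integral]
  refine integral_congr_ae ?_
  filter_upwards [coeFn_mulL m f] with x hx
  rw [hx]

lemma tri_comm (m : Linf) (f g : L2) : tri m f g = tri m g f := by
  rw [tri_eq_integral, tri_eq_integral]
  congr 1; ext x; ring

lemma tri_add_right (m : Linf) (f g h : L2) : tri m f (g + h) = tri m f g + tri m f h :=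
  inner_add_right _ _ _

lemma tri_sub_right (m : Linf) (f g h : L2) : tri m f (g - h) = tri m f g - tri m f h :=
  inner_sub_right _ _ _

lemma tri_smul_right (m : Linf) (c : ℝ) (f g : L2) : tri m f (c • g) = c * tri m f g :=
  real_inner_smul_right _ _ _

lemma tri_smul_weight (m : Linf) (c : ℝ) (f g : L2) : tri (c • m) f g = c * tri m f g := by
  rw [tri, map_smul, _root_.smul_apply, real_inner_smul_left, tri]

/-- Bounded continuous functions. -/
def IsBdd (θ : ℝ → ℝ) : Prop := Continuous θ ∧ ∃ C, ∀ x, |θ x| ≤ C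

lemma IsBdd.memLp {θ : ℝ → ℝ} (h : IsBdd θ) : MemLp θ ∞ (volume : Measure ℝ) := by
  obtain ⟨C, hC⟩ := h.2
  exact memLp_top_of_bound h.1.aestronglyMeasurable C (.of_forall hC)

/-- The class in `L^∞` of a bounded continuous function. -/
def IsBdd.toLinf {θ : ℝ → ℝ} (h : IsBdd θ) : Linf := h.memLp.toLp θ

lemma IsBdd.coeFn_toLinf {θ : ℝ → ℝ} (h : IsBdd θ) : h.toLinf =ᵐ[volume] θ :=
  h.memLp.coeFn_toLp

lemma norm_Linf_le (m : Linf) {C : ℝ} (hC : 0 ≤ C) (h : ∀ᵐ x, |m x| ≤ C) : ‖m‖ ≤ C := by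
  rw [Lp.norm_def]
  refine ENNReal.toReal_le_of_le_ofReal hC ?_
  rw [eLpNorm_exponent_top]
  exact eLpNormEssSup_le_of_ae_bound h

lemma IsBdd.tri_eq {θ : ℝ → ℝ} (h : IsBdd θ) (f g : L2) :
    tri h.toLinf f g = ∫ x, θ x * f x * g x := by
  rw [tri_eq_integral]
  refine integral_congr_ae ?_
  filter_upwards [h.coeFn_toLinf] with x hx
  rw [hx]

lemma IsBdd.integrable {θ : ℝ → ℝ} (h : IsBdd θ) (f g : L2) :
    Integrable fun x => θ x * f x * g x := by
  have h1 : Integrable fun x => mulL h.toLinf f x * g x :=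
    MemLp.integrable_mul (p := 2) (q := 2) (Lp.memLp _) (Lp.memLp g)
  refine h1.congr ?_
  filter_upwards [coeFn_mulL h.toLinf f, h.coeFn_toLinf] with x h2 h3
  rw [h2, h3]

/-! ### The embedding of `H¹` in `L^∞` -/

/-- `φ(x)²` is the integral of `2 φ φ' ≤ φ² + φ'²` over `(-∞, x]`. -/
lemma IsTest.sq_le_norm_sq {φ : ℝ → ℝ} (h : IsTest φ) (x : ℝ) : φ x ^ 2 ≤ ‖h.toH1‖ ^ 2 := by
  have hc : IsTest fun x => φ x * φ x := h.mul h
  have e1 : ∫ y in Iic x, _root_.deriv (fun x => φ x * φ x) y = φ x * φ x :=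
    hc.2.integral_Iic_deriv_eq (hc.1.of_le (by simp)) x
  have e2 : _root_.deriv (fun x => φ x * φ x) = fun y => 2 * (φ y * _root_.deriv φ y) := by
    ext y
    rw [deriv_fun_mul (h.differentiable y) (h.differentiable y)]; ring
  have i1 : Integrable fun y => φ y * φ y :=
    hc.1.continuous.integrable_of_hasCompactSupport hc.2
  have i2 : Integrable fun y => _root_.deriv φ y * _root_.deriv φ y :=
    (h.deriv.mul h.deriv).1.continuous.integrable_of_hasCompactSupport (h.deriv.mul h.deriv).2
  have i3 : Integrable fun y => 2 * (φ y * _root_.deriv φ y) :=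
    ((h.deriv.mul h).1.continuous.integrable_of_hasCompactSupport (h.deriv.mul h).2).const_mul 2
  have e3 : ‖h.toH1‖ ^ 2 = ∫ y, (φ y * φ y + _root_.deriv φ y * _root_.deriv φ y) := by
    rw [integral_add i1 i2, norm_sq_H1, ← real_inner_self_eq_norm_sq, ← real_inner_self_eq_norm_sq,
      val_toH1, der_toH1, inner_eq_integral, inner_eq_integral]
    congr 1
    · refine integral_congr_ae ?_
      filter_upwards [h.coeFn_toL2] with x hx
      rw [hx]
    · refine integral_congr_ae ?_
      filter_upwards [h.deriv.coeFn_toL2] with x hx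
      rw [hx]
  rw [e3, sq, ← e1, e2]
  refine (setIntegral_mono i3.integrableOn (i1.add i2).integrableOn fun y => ?_).trans
    (setIntegral_le_integral (i1.add i2) (.of_forall fun y => ?_))
  · have := sq_nonneg (φ y - _root_.deriv φ y)
    simp only [Pi.add_apply]; nlinarith
  · exact add_nonneg (mul_self_nonneg _) (mul_self_nonneg _)

/-- Approximate by test functions in `H¹` and pass to a subsequence converging almost everywhere. -/
lemma ae_abs_val_le_norm (f : H1) : ∀ᵐ x, |val f x| ≤ ‖f‖ := by
  have hf : f ∈ closure (testSubmodule : Set H1) := dense_testSubmodule f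
  obtain ⟨g, hg, hlim⟩ := mem_closure_iff_seq_limit.1 hf
  have hL : Tendsto (fun n => val (g n)) atTop (𝓝 (val f)) :=
    (val.continuous.tendsto f).comp hlim
  have hm := tendstoInMeasure_of_tendsto_Lp hL
  obtain ⟨ns, hns, hae⟩ := hm.exists_seq_tendsto_ae
  have hall : ∀ᵐ x, ∀ n, |val (g n) x| ≤ ‖g n‖ := by
    rw [ae_all_iff]
    intro n
    obtain ⟨φ, hφ, hn⟩ := hg n
    rw [hn]
    filter_upwards [hφ.coeFn_toL2] with x hx
    rw [IsTest.val_toH1, hx]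
    exact abs_le_of_sq_le_sq (hφ.sq_le_norm_sq x) (norm_nonneg _)
  filter_upwards [hae, hall] with x h1 h2
  exact le_of_tendsto_of_tendsto' h1.abs ((hlim.comp hns.tendsto_atTop).norm) fun n => h2 _

lemma memLp_top_val (f : H1) : MemLp (val f) ∞ (volume : Measure ℝ) :=
  memLp_top_of_bound (Lp.memLp _).1 ‖f‖ (ae_abs_val_le_norm f)

/-- The Sobolev embedding `H¹ ⊆ L^∞`. -/
def sup : H1 →L[ℝ] Linf :=
  LinearMap.mkContinuous
    { toFun := fun f => (memLp_top_val f).toLp _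
      map_add' := fun f g => by
        ext1
        filter_upwards [(memLp_top_val (f + g)).coeFn_toLp, (memLp_top_val f).coeFn_toLp,
          (memLp_top_val g).coeFn_toLp,
          Lp.coeFn_add ((memLp_top_val f).toLp _) ((memLp_top_val g).toLp _),
          Lp.coeFn_add (val f) (val g)] with x h1 h2 h3 h4 h5
        rw [h1, h4, Pi.add_apply, h2, h3, map_add, h5, Pi.add_apply]
      map_smul' := fun c f => by
        ext1
        filter_upwards [(memLp_top_val (c • f)).coeFn_toLp, (memLp_top_val f).coeFn_toLp,
          Lp.coeFn_smul c ((memLp_top_val f).toLp _),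
          Lp.coeFn_smul c (val f)] with x h1 h2 h4 h5
        rw [h1, RingHom.id_apply, h4, Pi.smul_apply, h2, map_smul, h5, Pi.smul_apply] }
    1 fun f => by
      rw [one_mul]
      refine norm_Linf_le _ (norm_nonneg _) ?_
      filter_upwards [(memLp_top_val f).coeFn_toLp, ae_abs_val_le_norm f] with x h1 h2
      exact h1 ▸ h2

lemma coeFn_sup (f : H1) : sup f =ᵐ[volume] val f := (memLp_top_val f).coeFn_toLp

/-! ### Integration by parts -/

/-- Smooth functions that are bounded together with their derivative. -/
structure IsWeight (θ : ℝ → ℝ) : Prop where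
  smooth : ContDiff ℝ ∞ θ
  bdd : IsBdd θ
  bdd_deriv : IsBdd (deriv θ)

@[fun_prop] lemma continuous_tri_right (m : Linf) (f : L2) : Continuous fun g => tri m f g := by
  unfold tri; fun_prop

/-- Both sides are continuous in `g`; for a test function `g` this is the weak derivative of `f`
tested against `θ g`. -/
lemma IsWeight.ibp {θ : ℝ → ℝ} (hθ : IsWeight θ) (f g : H1) :
    tri hθ.bdd.toLinf (val f) (der g) + tri hθ.bdd.toLinf (der f) (val g) =
      -tri hθ.bdd_deriv.toLinf (val f) (val g) := by
  refine H1_induction (P := fun g => tri hθ.bdd.toLinf (val f) (der g) +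
    tri hθ.bdd.toLinf (der f) (val g) = -tri hθ.bdd_deriv.toLinf (val f) (val g)) ?_ ?_ g
  · refine isClosed_eq ?_ ?_ <;> fun_prop
  · intro φ hφ
    have h := isWeakDeriv f _ (hφ.smooth_mul hθ.smooth)
    have hd : deriv (fun x => θ x * φ x) = fun x => deriv θ x * φ x + θ x * deriv φ x := by
      ext x
      exact deriv_fun_mul (hθ.smooth.differentiable (by simp) x) (hφ.differentiable x)
    have h1 := hθ.bdd_deriv.integrable (val f) hφ.toL2
    have h2 := hθ.bdd.integrable (val f) hφ.deriv.toL2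
    have e : ∫ x, val f x * deriv (fun x => θ x * φ x) x =
        (∫ x, deriv θ x * val f x * hφ.toL2 x) + ∫ x, θ x * val f x * hφ.deriv.toL2 x := by
      rw [← integral_add h1 h2, hd]
      refine integral_congr_ae ?_
      filter_upwards [hφ.coeFn_toL2, hφ.deriv.coeFn_toL2] with x h3 h4
      rw [h3, h4]; ring
    have e' : ∫ x, der f x * (θ x * φ x) = ∫ x, θ x * der f x * hφ.toL2 x := by
      refine integral_congr_ae ?_
      filter_upwards [hφ.coeFn_toL2] with x h3
      rw [h3]; ring
    rw [e, e', ← hθ.bdd.tri_eq, ← hθ.bdd.tri_eq, ← hθ.bdd_deriv.tri_eq] at h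
    rw [IsTest.val_toH1, IsTest.der_toH1]
    linarith

/-- The nonlinearity `r ∂ₓq + 2 q ∂ₓr`. -/
def nonlin (q r : H1) : L2 := mulL (sup r) (der q) + (2 : ℝ) • mulL (sup q) (der r)

lemma coeFn_nonlin (q r : H1) :
    nonlin q r =ᵐ[volume] fun x => val r x * der q x + 2 * val q x * der r x := by
  filter_upwards [Lp.coeFn_add (mulL (sup r) (der q)) ((2 : ℝ) • mulL (sup q) (der r)),
    Lp.coeFn_smul (2 : ℝ) (mulL (sup q) (der r)), coeFn_mulL (sup r) (der q),
    coeFn_mulL (sup q) (der r), coeFn_sup q, coeFn_sup r] with x h1 h2 h3 h4 h5 h6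
  rw [nonlin, h1, Pi.add_apply, h2, Pi.smul_apply, h3, h4, h5, h6, smul_eq_mul]
  ring

/-- The product `r (r ∂ₓq + 2 q ∂ₓr)` is the exact derivative `∂ₓ(q r²)`. By density `r` may be a
test function, and then `θ r²` is an admissible test function for `∂ₓq`. -/
lemma IsWeight.tri_nonlin {θ : ℝ → ℝ} (hθ : IsWeight θ) (q r : H1) :
    tri hθ.bdd.toLinf (val r) (nonlin q r) =
      -tri hθ.bdd_deriv.toLinf (val r) (mulL (sup q) (val r)) := by
  refine H1_induction (P := fun r => tri hθ.bdd.toLinf (val r) (nonlin q r) =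
      -tri hθ.bdd_deriv.toLinf (val r) (mulL (sup q) (val r))) ?_ ?_ r
  · unfold tri nonlin
    refine isClosed_eq ?_ ?_ <;> fun_prop
  · intro φ hφ
    have h := isWeakDeriv q _ ((hφ.mul hφ).smooth_mul hθ.smooth)
    have hd : deriv (fun x => θ x * (φ x * φ x)) =
        fun x => deriv θ x * (φ x * φ x) + θ x * (2 * φ x * deriv φ x) := by
      ext x
      have h0 := hφ.differentiable x
      have h0' : DifferentiableAt ℝ (fun x => φ x * φ x) x := h0.mul h0
      rw [deriv_fun_mul (hθ.smooth.differentiable (by simp) x) h0',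
        deriv_fun_mul h0 h0]
      ring
    have h1 := hθ.bdd_deriv.integrable hφ.toL2 (mulL (sup q) hφ.toL2)
    have h2 := hθ.bdd.integrable hφ.toL2 (mulL (sup q) hφ.deriv.toL2)
    have h3 := hθ.bdd.integrable hφ.toL2 (mulL (sup hφ.toH1) (der q))
    have e : ∫ x, val q x * deriv (fun x => θ x * (φ x * φ x)) x =
        tri hθ.bdd_deriv.toLinf hφ.toL2 (mulL (sup q) hφ.toL2) +
          2 * tri hθ.bdd.toLinf hφ.toL2 (mulL (sup q) hφ.deriv.toL2) := by
      rw [IsBdd.tri_eq, IsBdd.tri_eq, ← integral_const_mul, ← integral_add h1 (h2.const_mul 2), hd]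
      refine integral_congr_ae ?_
      filter_upwards [hφ.coeFn_toL2, hφ.deriv.coeFn_toL2, coeFn_mulL (sup q) hφ.toL2,
        coeFn_mulL (sup q) hφ.deriv.toL2, coeFn_sup q] with x h3 h4 h5 h6 h7
      rw [h5, h6, h3, h4, h7]; ring
    have e' : ∫ x, der q x * (θ x * (φ x * φ x)) =
        tri hθ.bdd.toLinf hφ.toL2 (mulL (sup hφ.toH1) (der q)) := by
      rw [IsBdd.tri_eq]
      refine integral_congr_ae ?_
      filter_upwards [hφ.coeFn_toL2, coeFn_mulL (sup hφ.toH1) (der q),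
        coeFn_sup hφ.toH1] with x h3 h4 h5
      rw [h4, h5, IsTest.val_toH1, h3]; ring
    rw [e, e'] at h
    rw [nonlin, IsTest.val_toH1, IsTest.der_toH1, tri_add_right, tri_smul_right]
    linarith

/-! ### The operator `(1 - b ∂ₓ²)⁻¹` -/

/-- The bilinear form `⟪f, g⟫ + b ⟪f', g'⟫` on `H¹`. -/
def helmholtzForm (b : ℝ) : H1 →L[ℝ] H1 →L[ℝ] ℝ :=
  (innerSL ℝ).bilinearComp val val + b • (innerSL ℝ).bilinearComp der der

lemma helmholtzForm_apply (b : ℝ) (f g : H1) :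
    helmholtzForm b f g = inner ℝ (val f) (val g) + b * inner ℝ (der f) (der g) := rfl

lemma isCoercive_helmholtzForm {b : ℝ} (hb : 0 < b) : IsCoercive (helmholtzForm b) := by
  refine ⟨min 1 b, lt_min one_pos hb, fun f => ?_⟩
  rw [helmholtzForm_apply, real_inner_self_eq_norm_sq, real_inner_self_eq_norm_sq, mul_assoc,
    ← sq, norm_sq_H1, mul_add]
  refine add_le_add ?_ (mul_le_mul_of_nonneg_right (min_le_right _ _) (sq_nonneg _))
  simpa using mul_le_mul_of_nonneg_right (min_le_left 1 b) (sq_nonneg ‖val f‖)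

/-- The operator `(1 - b ∂ₓ²)⁻¹ : L² → H¹`. -/
def helmholtzInv {b : ℝ} (hb : 0 < b) : L2 →L[ℝ] H1 :=
  (isCoercive_helmholtzForm hb).continuousLinearEquivOfBilin.symm.toContinuousLinearMap.comp
    (ContinuousLinearMap.adjoint val)

/-- Lax–Milgram: the adjoint of `val` represents `⟪f, val ·⟫` in `H¹`, and coercivity inverts the
form. -/
lemma helmholtzInv_spec {b : ℝ} (hb : 0 < b) (f : L2) (h : H1) :
    inner ℝ (val (helmholtzInv hb f)) (val h) + b * inner ℝ (der (helmholtzInv hb f)) (der h) =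
      inner ℝ f (val h) := by
  rw [← helmholtzForm_apply,
    ← (isCoercive_helmholtzForm hb).continuousLinearEquivOfBilin_apply, helmholtzInv,
    ContinuousLinearMap.comp_apply, ContinuousLinearEquiv.coe_coe,
    ContinuousLinearEquiv.apply_symm_apply, ContinuousLinearMap.adjoint_inner_left]

lemma isWeakDeriv_der_helmholtzInv {b : ℝ} (hb : 0 < b) (f : L2) :
    IsWeakDeriv (der (helmholtzInv hb f)) (b⁻¹ • (val (helmholtzInv hb f) - f)) := by
  rw [isWeakDeriv_iff_inner]
  intro φ hφ
  have h := helmholtzInv_spec hb f hφ.toH1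
  rw [IsTest.val_toH1, IsTest.der_toH1] at h
  rw [real_inner_smul_left, inner_sub_left]
  field_simp
  linarith

/-- The derivative of `(1 - b ∂ₓ²)⁻¹ f`, as an element of `H¹`. -/
def derHelmholtzInv {b : ℝ} (hb : 0 < b) (f : L2) : H1 :=
  (isWeakDeriv_der_helmholtzInv hb f).toH1

lemma val_derHelmholtzInv {b : ℝ} (hb : 0 < b) (f : L2) :
    val (derHelmholtzInv hb f) = der (helmholtzInv hb f) := rfl

lemma der_derHelmholtzInv {b : ℝ} (hb : 0 < b) (f : L2) :
    der (derHelmholtzInv hb f) = b⁻¹ • (val (helmholtzInv hb f) - f) := rfl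

/-- This is `M - b M'' = f` multiplied by `θ M` and integrated by parts; it yields the weighted
bounds on `M`. -/
lemma IsWeight.helmholtz_identity {θ : ℝ → ℝ} (hθ : IsWeight θ) {b : ℝ} (hb : 0 < b) (f : L2) :
    tri hθ.bdd.toLinf (val (helmholtzInv hb f)) (val (helmholtzInv hb f)) +
      b * tri hθ.bdd.toLinf (der (helmholtzInv hb f)) (der (helmholtzInv hb f)) +
      b * tri hθ.bdd_deriv.toLinf (val (helmholtzInv hb f)) (der (helmholtzInv hb f)) =
      tri hθ.bdd.toLinf (val (helmholtzInv hb f)) f := by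
  have h := hθ.ibp (helmholtzInv hb f) (derHelmholtzInv hb f)
  rw [val_derHelmholtzInv, der_derHelmholtzInv, tri_smul_right, tri_sub_right] at h
  field_simp at h
  linarith

/-! ### The potential `a ∂ₓq - b ∂ₜr` -/

section Potential

variable {b : ℝ} (a : ℝ) (hb : 0 < b)

/-- The solution `G` of `G - b G'' = b n - (b - a) q'`. -/
def potential (q : H1) (n : L2) : H1 :=
  b • helmholtzInv hb n - (b - a) • derHelmholtzInv hb (val q)

/-- The derivative of `potential`, as an element of `H¹`. -/
def potentialDer (q : H1) (n : L2) : H1 :=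
  b • derHelmholtzInv hb n + ((b - a) / b) • (q - helmholtzInv hb (val q))

lemma val_potential (q : H1) (n : L2) : val (potential a hb q n) =
    b • val (helmholtzInv hb n) - (b - a) • der (helmholtzInv hb (val q)) := rfl

lemma der_potential (q : H1) (n : L2) :
    der (potential a hb q n) = val (potentialDer a hb q n) := by
  simp only [potential, potentialDer, map_sub, map_smul, map_add, val_derHelmholtzInv,
    der_derHelmholtzInv]
  module

lemma val_potentialDer (q : H1) (n : L2) : val (potentialDer a hb q n) =
    b • der (helmholtzInv hb n) + ((b - a) / b) • (val q - val (helmholtzInv hb (val q))) := rfl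

/-- This is `b G'' = G - b n + (b - a) ∂ₓq` with `G = a ∂ₓq - b w` substituted. -/
lemma der_potentialDer (q : H1) (n w : L2)
    (hw : b • w = a • der q - val (potential a hb q n)) :
    der (potentialDer a hb q n) = der q - w - n := by
  have hb' := hb.ne'
  have hw' : w = b⁻¹ • (a • der q - val (potential a hb q n)) := by
    rw [← hw, smul_smul, inv_mul_cancel₀ hb', one_smul]
  rw [hw', val_potential]
  simp only [potentialDer, map_sub, map_smul, map_add, der_derHelmholtzInv]
  match_scalars <;> field_simp

lemma eq_zero_of_inner_helmholtz {b : ℝ} (hb : 0 < b) (G : L2)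
    (hG : ∀ φ (h : IsTest φ), inner ℝ G (h.toL2 - b • h.deriv.deriv.toL2) = 0) : G = 0 := by
  refine eq_zero_of_helmholtz hb G fun φ hφ => ?_
  have h := hG φ hφ
  rw [inner_sub_right, real_inner_smul_right, inner_toL2, inner_toL2] at h
  rw [← h, ← integral_const_mul, ← integral_sub (integrable_mul_test G hφ)
    ((integrable_mul_test G hφ.deriv.deriv).const_mul b)]
  congr 1; ext x; ring

/-- Both `a ∂ₓq - b w` and the potential solve the same Helmholtz equation distributionally;
uniqueness in `L²` identifies them. -/
lemma eq_potential {u : State} {w : L2} (h : IsSecondComponent a b u w) :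
    b • w = a • der u.fst - val (potential a hb u.fst (nonlin u.fst u.snd)) := by
  set q : H1 := u.fst
  set n := nonlin q u.snd with hn
  suffices a • der q - b • w - val (potential a hb q n) = 0 by
    rw [← sub_eq_zero, ← neg_eq_zero, ← this]; abel
  refine eq_zero_of_inner_helmholtz hb _ fun φ hφ => ?_
  have hphi := h φ hφ
  have e1 : ∀ (c : ℝ) (f : L2), ∫ x, f x * (φ x - c * deriv (deriv φ) x) =
      inner ℝ f hφ.toL2 - c * inner ℝ f hφ.deriv.deriv.toL2 := by
    intro c f
    rw [inner_toL2, inner_toL2, ← integral_const_mul, ← integral_sub (integrable_mul_test f hφ)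
      ((integrable_mul_test f hφ.deriv.deriv).const_mul c)]
    congr 1; ext x; ring
  have e2 : ∫ x, (u.r x * u.qx x + 2 * u.q x * u.rx x) * φ x = inner ℝ n hφ.toL2 := by
    rw [inner_toL2]
    refine integral_congr_ae ?_
    filter_upwards [coeFn_nonlin q u.snd] with x hx
    rw [hn, hx]; rfl
  rw [e1, e1, e2] at hphi
  have hqx : u.qx = der q := rfl
  rw [hqx] at hphi
  have k1 := helmholtzInv_spec hb n hφ.toH1
  have k2 := isWeakDeriv_iff_inner.1 (isWeakDeriv (helmholtzInv hb n)) _ hφ.deriv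
  have k3 := isWeakDeriv_iff_inner.1 (isWeakDeriv (helmholtzInv hb (val q))) _ hφ
  have k4 := isWeakDeriv_iff_inner.1 (isWeakDeriv (derHelmholtzInv hb (val q))) _ hφ.deriv
  have k5 := isWeakDeriv_iff_inner.1 (isWeakDeriv q) _ hφ
  rw [IsTest.val_toH1, IsTest.der_toH1] at k1
  rw [val_derHelmholtzInv, der_derHelmholtzInv, real_inner_smul_left, inner_sub_left] at k4
  field_simp at k4
  rw [val_potential]
  simp only [inner_sub_left, inner_sub_right, real_inner_smul_left, real_inner_smul_right]
  linear_combination (-b) * hphi + (-b) * k1 + b ^ 2 * k2 + (b - a) * (- k4 + k3 - k5)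

/-- The balance law for the weighted energy of the linear system with forcing. -/
lemma IsWeight.flux_identity {θ : ℝ → ℝ} (hθ : IsWeight θ) (ha : a ≠ 0) (q r p w : H1) (n : L2)
    (hp : val p = der r) (hw : b • val w = a • der q - val (potential a hb q n)) :
    tri hθ.bdd.toLinf (val q) (val p) + tri hθ.bdd.toLinf (val r) (val w) +
      a * tri hθ.bdd.toLinf (der q) (der p) + b * tri hθ.bdd.toLinf (der r) (der w) =
    -(tri hθ.bdd_deriv.toLinf (val q) (val r) + a * tri hθ.bdd_deriv.toLinf (der q) (der r) -
      tri hθ.bdd_deriv.toLinf (val r) (val (potentialDer a hb q n))) -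
      tri hθ.bdd.toLinf (val r) n := by
  set G := potential a hb q n
  set K := potentialDer a hb q n
  -- Since `w ∈ H¹`, the relation `a ∂ₓq = G + b w` puts `∂ₓq` itself in `H¹`, so it may be
  -- integrated by parts.
  set Q : H1 := a⁻¹ • (G + b • w) with hQ
  have hQv : val Q = der q := by
    rw [hQ, map_smul, map_add, map_smul, hw, add_sub_cancel, smul_smul, inv_mul_cancel₀ ha,
      one_smul]
  have hQd : a • der Q = val K + b • der w := by
    rw [hQ, map_smul, map_add, map_smul, smul_smul, mul_inv_cancel₀ ha, one_smul, der_potential]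
  have hK : der K = der q - val w - n := der_potentialDer a hb q n (val w) hw
  have i1 := hθ.ibp q r
  have i2 := hθ.ibp p Q
  have i3 := hθ.ibp r K
  rw [hQv, hp] at i2
  rw [hK, tri_sub_right, tri_sub_right] at i3
  have i4 : a * tri hθ.bdd.toLinf (der r) (der Q) =
      tri hθ.bdd.toLinf (der r) (val K) + b * tri hθ.bdd.toLinf (der r) (der w) := by
    rw [← tri_smul_right, hQd, tri_add_right, tri_smul_right]
  rw [hp]
  have s1 := tri_comm hθ.bdd.toLinf (der q) (val r)
  have s2 := tri_comm hθ.bdd.toLinf (der q) (der p)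
  have s3 := tri_comm hθ.bdd_deriv.toLinf (der q) (der r)
  linear_combination i1 + a * i2 - i3 - i4 + a * s2 + a * s3 - s1

end Potential

/-! ### Translates of weights -/

lemma IsBdd.shift {θ : ℝ → ℝ} (h : IsBdd θ) (y : ℝ) : IsBdd fun x => θ (x - y) :=
  ⟨h.1.comp (continuous_id.sub continuous_const), h.2.imp fun _ hC _ => hC _⟩

lemma deriv_shift (θ : ℝ → ℝ) (y : ℝ) : deriv (fun x => θ (x - y)) = fun x => deriv θ (x - y) :=
  funext fun x => deriv_comp_sub_const θ y x

lemma IsWeight.shift {θ : ℝ → ℝ} (h : IsWeight θ) (y : ℝ) : IsWeight fun x => θ (x - y) :=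
  ⟨h.smooth.comp (contDiff_id.sub contDiff_const), h.bdd.shift y,
    deriv_shift θ y ▸ h.bdd_deriv.shift y⟩

lemma toLinf_congr {θ₁ θ₂ : ℝ → ℝ} (h₁ : IsBdd θ₁) (h₂ : IsBdd θ₂) (h : θ₁ = θ₂) :
    h₁.toLinf = h₂.toLinf := by
  subst h; rfl

lemma IsWeight.toLinf_deriv_shift {θ : ℝ → ℝ} (h : IsWeight θ) (y : ℝ) :
    (h.shift y).bdd_deriv.toLinf = (h.bdd_deriv.shift y).toLinf :=
  toLinf_congr _ _ (deriv_shift θ y)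

lemma continuous_toLinf_shift {θ : ℝ → ℝ} (h : IsBdd θ) (hd : Differentiable ℝ θ)
    (h' : IsBdd (deriv θ)) : Continuous fun y => (h.shift y).toLinf := by
  obtain ⟨C, hC⟩ := h'.2
  have hC0 : 0 ≤ C := (abs_nonneg _).trans (hC 0)
  refine (LipschitzWith.of_dist_le_mul (K := C.toNNReal) fun y z => ?_).continuous
  rw [dist_eq_norm, Real.coe_toNNReal _ hC0]
  refine norm_Linf_le _ (by positivity) ?_
  filter_upwards [Lp.coeFn_sub (h.shift y).toLinf (h.shift z).toLinf, (h.shift y).coeFn_toLinf,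
    (h.shift z).coeFn_toLinf] with x h1 h2 h3
  rw [h1, Pi.sub_apply, h2, h3]
  have := convex_univ.norm_image_sub_le_of_norm_deriv_le (f := θ) (C := C) (x := x - z)
    (y := x - y) (fun x _ => hd x) (fun x _ => hC x) (mem_univ _) (mem_univ _)
  rw [Real.norm_eq_abs] at this
  refine this.trans_eq ?_
  rw [sub_sub_sub_cancel_left, Real.dist_eq, Real.norm_eq_abs, abs_sub_comm]

lemma abs_taylor_le {θ : ℝ → ℝ} (hd : Differentiable ℝ θ) (hd' : Differentiable ℝ (deriv θ)) {C : ℝ}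
    (hC : ∀ x, |deriv (deriv θ) x| ≤ C) (s t : ℝ) :
    |θ t - θ s - (t - s) * deriv θ s| ≤ C * |t - s| ^ 2 := by
  have h1 : ∀ x ∈ segment ℝ s t, ‖deriv θ x - deriv θ s‖ ≤ C * |t - s| := by
    intro x hx
    have := convex_univ.norm_image_sub_le_of_norm_deriv_le (f := deriv θ) (C := C) (x := s)
      (y := x) (fun x _ => hd' x) (fun x _ => hC x) (mem_univ _) (mem_univ _)
    refine this.trans (mul_le_mul_of_nonneg_left ?_ ((abs_nonneg _).trans (hC 0)))
    simpa using norm_sub_le_of_mem_segment hx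
  have h2 := (convex_segment s t).norm_image_sub_le_of_norm_hasDerivWithin_le
    (f := fun x => θ x - x * deriv θ s) (f' := fun x => deriv θ x - deriv θ s)
    (fun x _ => ((hd x).hasDerivAt.sub
      ((hasDerivAt_mul_const (deriv θ s) (x := x)))).hasDerivWithinAt) h1
    (left_mem_segment ℝ s t) (right_mem_segment ℝ s t)
  rw [Real.norm_eq_abs, Real.norm_eq_abs] at h2
  convert h2 using 1
  · congr 1; ring
  · ring

/-- The derivative exists in the `L^∞` norm because the Taylor remainder is quadratic, uniformly in
`x`. -/
lemma IsWeight.hasDerivAt_shift {θ : ℝ → ℝ} (h : IsWeight θ) (h2 : IsBdd (deriv (deriv θ)))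
    (y : ℝ) : HasDerivAt (fun y => (h.bdd.shift y).toLinf) (-(h.bdd_deriv.shift y).toLinf) y := by
  obtain ⟨C, hC⟩ := h2.2
  have hC0 : 0 ≤ C := (abs_nonneg _).trans (hC 0)
  have hd : Differentiable ℝ θ := h.smooth.differentiable (by simp)
  have hd' : Differentiable ℝ (deriv θ) :=
    ((contDiff_infty_iff_deriv (𝕜 := ℝ)).1 h.smooth).2.differentiable (by simp)
  rw [hasDerivAt_iff_isLittleO]
  refine Asymptotics.IsBigO.trans_isLittleO (Asymptotics.IsBigO.of_bound C (.of_forall fun z => ?_))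
    (Asymptotics.isLittleO_pow_sub_sub y one_lt_two)
  refine norm_Linf_le _ (by positivity) ?_
  set A := (h.bdd.shift z).toLinf
  set B := (h.bdd.shift y).toLinf
  set D := (h.bdd_deriv.shift y).toLinf
  filter_upwards [Lp.coeFn_sub (A - B) ((z - y) • -D), Lp.coeFn_sub A B,
    Lp.coeFn_smul (z - y) (-D), Lp.coeFn_neg D, (h.bdd.shift z).coeFn_toLinf,
    (h.bdd.shift y).coeFn_toLinf, (h.bdd_deriv.shift y).coeFn_toLinf] with x e1 e2 e3 e4 e5 e6 e7
  rw [e1, Pi.sub_apply, e2, e3, Pi.sub_apply, Pi.smul_apply, e4, Pi.neg_apply, e5, e6, e7]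
  have := abs_taylor_le hd hd' hC (x - y) (x - z)
  rw [sub_sub_sub_cancel_left] at this
  rw [norm_pow, norm_norm, Real.norm_eq_abs, abs_sub_comm z y]
  convert this using 2
  rw [smul_eq_mul]; ring

/-! ### Time averages -/

section Average

variable {E F : Type*} [NormedAddCommGroup E] [NormedSpace ℝ E] [CompleteSpace E]
  [NormedAddCommGroup F] [NormedSpace ℝ F] [CompleteSpace F]

/-- The average of `f` over the interval between `s` and `s + η`. -/
def avg (f : ℝ → E) (η s : ℝ) : E := ∫ τ in (0 : ℝ)..1, f (s + η * τ)

omit [CompleteSpace E] in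
-- Averaging over the fixed parameter interval `[0, 1]` keeps `η = 0` admissible, so the limit `η →
-- 0` is an evaluation.
lemma continuous_avg {f : ℝ → E} (hf : Continuous f) :
    Continuous fun p : ℝ × ℝ => avg f p.1 p.2 := by
  refine intervalIntegral.continuous_parametric_intervalIntegral_of_continuous' ?_ 0 1
  exact hf.comp (by fun_prop)

@[simp] lemma avg_zero (f : ℝ → E) (s : ℝ) : avg f 0 s = f s := by
  simp [avg]

omit [CompleteSpace E] in
lemma avg_eq (f : ℝ → E) {η : ℝ} (hη : η ≠ 0) (s : ℝ) :
    avg f η s = η⁻¹ • ∫ τ in s..s + η, f τ := by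
  rw [avg, intervalIntegral.integral_comp_add_mul _ hη]
  simp

lemma avg_of_hasDerivAt {g g' : ℝ → E} (hg : ∀ t, HasDerivAt g (g' t) t) (hg' : Continuous g')
    {η : ℝ} (hη : η ≠ 0) (s : ℝ) : avg g' η s = η⁻¹ • (g (s + η) - g s) := by
  rw [avg_eq g' hη, intervalIntegral.integral_eq_sub_of_hasDerivAt (fun t _ => hg t)
    (hg'.intervalIntegrable _ _)]

lemma hasDerivAt_avg {f : ℝ → E} (hf : Continuous f) {η : ℝ} (hη : η ≠ 0) (s : ℝ) :
    HasDerivAt (avg f η) (η⁻¹ • (f (s + η) - f s)) s := by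
  have hP : ∀ t, HasDerivAt (fun t => ∫ τ in (0 : ℝ)..t, f τ) (f t) t := fun t =>
    hf.integral_hasStrictDerivAt 0 t |>.hasDerivAt
  have e : avg f η = fun s => η⁻¹ • ((∫ τ in (0 : ℝ)..s + η, f τ) - ∫ τ in (0 : ℝ)..s, f τ) := by
    ext s
    rw [avg_eq f hη, intervalIntegral.integral_interval_sub_left
      (hf.intervalIntegrable _ _) (hf.intervalIntegrable _ _)]
  rw [e]
  exact (((hP (s + η)).comp_add_const s η).sub (hP s)).const_smul η⁻¹

lemma map_avg (L : E →L[ℝ] F) {f : ℝ → E} (hf : Continuous f) (η s : ℝ) :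
    L (avg f η s) = avg (fun t => L (f t)) η s := by
  rw [avg, avg, L.intervalIntegral_comp_comm]
  exact (hf.comp (by fun_prop)).intervalIntegrable _ _

end Average

/-! ### The balance law -/

/-- The quadratic energy form with weight `m`. -/
def energyForm (a b : ℝ) (m : Linf) (u : State) : ℝ :=
  (1 / 2) * (tri m (val u.fst) (val u.fst) + tri m (val u.snd) (val u.snd) +
    a * tri m (der u.fst) (der u.fst) + b * tri m (der u.snd) (der u.snd))

@[fun_prop] lemma Continuous.tri {X : Type*} [TopologicalSpace X] {m : X → Linf} {f g : X → L2}
    (hm : Continuous m) (hf : Continuous f) (hg : Continuous g) :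
    Continuous fun x => tri (m x) (f x) (g x) := by
  unfold BenneyLuke.tri; fun_prop

lemma hasDerivAt_tri_self {m : ℝ → Linf} {f : ℝ → L2} {m' : Linf} {f' : L2} {s : ℝ}
    (hm : HasDerivAt m m' s) (hf : HasDerivAt f f' s) :
    HasDerivAt (fun s => tri (m s) (f s) (f s))
      (tri m' (f s) (f s) + 2 * tri (m s) (f s) f') s := by
  have h1 : HasDerivAt (fun s => mulL (m s)) (mulL m') s := mulL.hasFDerivAt.comp_hasDerivAt s hm
  have h2 := (h1.clm_apply hf).inner ℝ hf
  refine h2.congr_deriv ?_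
  have h3 := tri_comm (m s) f' (f s)
  unfold tri at *
  rw [inner_add_left, h3]; ring

/-- The quadratic part of the time derivative of the weighted energy. -/
def fluxForm (a : ℝ) {b : ℝ} (hb : 0 < b) (m : Linf) (u : State) (n : L2) : ℝ :=
  tri m (val u.fst) (val u.snd) + a * tri m (der u.fst) (der u.snd) -
    tri m (val u.snd) (val (potentialDer a hb u.fst n))

/-- `b ∂ₜr` as a linear function of `q` and the nonlinearity. -/
def rate (a : ℝ) {b : ℝ} (hb : 0 < b) : H1 × L2 →L[ℝ] L2 :=
  a • der.comp (.fst ℝ H1 L2) - (b • val.comp ((helmholtzInv hb).comp (.snd ℝ H1 L2)) -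
    (b - a) • der.comp ((helmholtzInv hb).comp (val.comp (.fst ℝ H1 L2))))

lemma rate_apply (a : ℝ) {b : ℝ} (hb : 0 < b) (q : H1) (n : L2) :
    rate a hb (q, n) = a • der q - val (potential a hb q n) := rfl

lemma continuous_nonlin {X : Type*} [TopologicalSpace X] {u : X → State} (hu : Continuous u) :
    Continuous fun x => nonlin (u x).fst (u x).snd := by
  unfold nonlin; fun_prop

section Balance

variable {a b : ℝ} (ha : a ≠ 0) (hb : 0 < b) {v : ℝ → State} (hv : IsSolution a b v)
  {y : ℝ → ℝ} (hy : ContDiff ℝ 1 y) {θ : ℝ → ℝ} (hθ : IsWeight θ)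
  (hθ2 : IsBdd (deriv (deriv θ)))

include ha hv hy hθ2

/-- The time derivative of the average is a difference quotient of `v`, hence in `H¹`. The linear
operators commute with averaging, so `IsWeight.flux_identity` applies with the average of the
nonlinearity, not the nonlinearity of the average, as forcing. -/
lemma hasDerivAt_energyForm_avg {η : ℝ} (hη : η ≠ 0) (s : ℝ) :
    HasDerivAt (fun s => energyForm a b (hθ.bdd.shift (y s)).toLinf (avg v η s))
      (-(deriv y s) * energyForm a b (hθ.bdd_deriv.shift (y s)).toLinf (avg v η s) -
        fluxForm a hb (hθ.bdd_deriv.shift (y s)).toLinf (avg v η s)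
          (avg (fun t => nonlin (v t).fst (v t).snd) η s) -
        tri (hθ.bdd.shift (y s)).toLinf (val (avg v η s).snd)
          (avg (fun t => nonlin (v t).fst (v t).snd) η s)) s := by
  have hvc := hv.continuous
  set n : ℝ → L2 := fun t => nonlin (v t).fst (v t).snd with hn
  have hnc : Continuous n := continuous_nonlin hvc
  set V := avg v η with hV
  set D : State := η⁻¹ • (v (s + η) - v s) with hD
  have hVd : HasDerivAt V D s := hasDerivAt_avg hvc hη s
  have hp : val D.fst = der (V s).snd := by
    have e1 : der (V s).snd = avg (fun t => der (v t).snd) η s :=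
      map_avg (der.comp (WithLp.sndL 2 ℝ H1 H1)) hvc η s
    rw [e1, avg_of_hasDerivAt (g := fun t => val (v t).fst)
      (g' := fun t => der (v t).snd) (fun t => hv.eq_q t)
      (by fun_prop) hη]
    simp [hD]
  have hw : b • val D.snd = a • der (V s).fst - val (potential a hb (V s).fst (avg n η s)) := by
    have hr : ∀ t, HasDerivAt (fun t => val (v t).snd) (b⁻¹ • rate a hb ((v t).fst, n t)) t := by
      intro t
      obtain ⟨w, hw, hd⟩ := hv.eq_r t
      rw [rate_apply, ← eq_potential a hb hw, smul_smul, inv_mul_cancel₀ hb.ne', one_smul]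
      exact hd
    have hpc : Continuous fun t => ((v t).fst, n t) := by fun_prop
    have e1 : val D.snd = avg (fun t => b⁻¹ • rate a hb ((v t).fst, n t)) η s := by
      rw [avg_of_hasDerivAt hr (by fun_prop) hη]
      simp [hD]
    have e2 := map_avg (b⁻¹ • rate a hb) hpc η s
    have e3 : avg (fun t => ((v t).fst, n t)) η s = ((V s).fst, avg n η s) := by
      refine Prod.ext ?_ ?_
      · have h1 := map_avg (ContinuousLinearMap.fst ℝ H1 L2) hpc η s
        have h2 := map_avg (WithLp.fstL 2 ℝ H1 H1) hvc η s
        exact h1.trans h2.symm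
      · exact map_avg (ContinuousLinearMap.snd ℝ H1 L2) hpc η s
    have e4 : val D.snd = b⁻¹ • rate a hb ((V s).fst, avg n η s) := by
      rw [e1, ← e3]; exact e2.symm
    rw [e4, smul_smul, mul_inv_cancel₀ hb.ne', one_smul, rate_apply]
  have hflux := (hθ.shift (y s)).flux_identity a hb ha (V s).fst (V s).snd D.fst D.snd
    (avg n η s) hp hw
  rw [hθ.toLinf_deriv_shift] at hflux
  have hyd : HasDerivAt y (deriv y s) s := (hy.differentiable (by simp) s).hasDerivAt
  have hm : HasDerivAt (fun s => (hθ.bdd.shift (y s)).toLinf)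
      (deriv y s • -(hθ.bdd_deriv.shift (y s)).toLinf) s :=
    (hθ.hasDerivAt_shift hθ2 (y s)).scomp s hyd
  have hL : ∀ L : State →L[ℝ] L2, HasDerivAt (fun s => L (V s)) (L D) s := fun L =>
    L.hasFDerivAt.comp_hasDerivAt s hVd
  have h1 := hasDerivAt_tri_self hm (hL (val.comp (WithLp.fstL 2 ℝ H1 H1)))
  have h2 := hasDerivAt_tri_self hm (hL (val.comp (WithLp.sndL 2 ℝ H1 H1)))
  have h3 := hasDerivAt_tri_self hm (hL (der.comp (WithLp.fstL 2 ℝ H1 H1)))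
  have h4 := hasDerivAt_tri_self hm (hL (der.comp (WithLp.sndL 2 ℝ H1 H1)))
  have hall := (((h1.add h2).add (h3.const_mul a)).add (h4.const_mul b)).const_mul (1 / 2)
  refine hall.congr_deriv ?_
  have hneg : deriv y s • -(hθ.bdd_deriv.shift (y s)).toLinf =
    (-deriv y s) • (hθ.bdd_deriv.shift (y s)).toLinf := by rw [smul_neg, neg_smul]
  rw [hneg]
  simp only [tri_smul_weight, ContinuousLinearMap.comp_apply, WithLp.fstL_apply,
    WithLp.sndL_apply, energyForm, fluxForm]
  linear_combination hflux

/-- The balance law for the weighted energy. -/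
theorem energyForm_balance (t : ℝ) :
    energyForm a b (hθ.bdd.shift (y t)).toLinf (v t) -
      energyForm a b (hθ.bdd.shift (y 0)).toLinf (v 0) =
    ∫ s in (0 : ℝ)..t,
      (-(deriv y s) * energyForm a b (hθ.bdd_deriv.shift (y s)).toLinf (v s) -
        fluxForm a hb (hθ.bdd_deriv.shift (y s)).toLinf (v s)
          (nonlin (v s).fst (v s).snd) +
        tri (hθ.bdd_deriv.shift (y s)).toLinf (val (v s).snd)
          (mulL (sup (v s).fst) (val (v s).snd))) := by
  have hvc := hv.continuous
  set n : ℝ → L2 := fun t => nonlin (v t).fst (v t).snd with hn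
  have hnc : Continuous n := continuous_nonlin hvc
  have hyc := hy.continuous
  have hyd : Continuous (deriv y) := hy.continuous_deriv (by simp)
  have hd : Differentiable ℝ θ := hθ.smooth.differentiable (by simp)
  have hd' : Differentiable ℝ (deriv θ) :=
    ((contDiff_infty_iff_deriv (𝕜 := ℝ)).1 hθ.smooth).2.differentiable (by simp)
  have hm : Continuous fun s => (hθ.bdd.shift (y s)).toLinf :=
    (continuous_toLinf_shift hθ.bdd hd hθ.bdd_deriv).comp hyc
  have hm' : Continuous fun s => (hθ.bdd_deriv.shift (y s)).toLinf :=
    (continuous_toLinf_shift hθ.bdd_deriv hd' hθ2).comp hyc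
  set Ψ : ℝ → ℝ → ℝ := fun η s =>
    -(deriv y s) * energyForm a b (hθ.bdd_deriv.shift (y s)).toLinf (avg v η s) -
        fluxForm a hb (hθ.bdd_deriv.shift (y s)).toLinf (avg v η s) (avg n η s) -
        tri (hθ.bdd.shift (y s)).toLinf (val (avg v η s).snd) (avg n η s) with hΨ
  have cV := continuous_avg hvc
  have cn := continuous_avg hnc
  have hΨc : Continuous (Function.uncurry Ψ) := by
    have c1 : Continuous fun p : ℝ × ℝ => deriv y p.2 := hyd.comp continuous_snd
    have c2 : Continuous fun p : ℝ × ℝ => (hθ.bdd_deriv.shift (y p.2)).toLinf :=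
      hm'.comp continuous_snd
    have c3 : Continuous fun p : ℝ × ℝ => (hθ.bdd.shift (y p.2)).toLinf :=
      hm.comp continuous_snd
    simp only [hΨ, Function.uncurry_def, energyForm, fluxForm, val_potentialDer]
    fun_prop
  have hW : Continuous fun η => energyForm a b (hθ.bdd.shift (y t)).toLinf (avg v η t) -
      energyForm a b (hθ.bdd.shift (y 0)).toLinf (avg v η 0) := by
    have c1 : Continuous fun η => avg v η t := cV.comp (by fun_prop : Continuous fun η => (η, t))
    have c2 : Continuous fun η => avg v η 0 :=
      cV.comp (by fun_prop : Continuous fun η => (η, (0 : ℝ)))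
    simp only [energyForm]
    fun_prop
  have hI : Continuous fun η => ∫ s in (0 : ℝ)..t, Ψ η s :=
    intervalIntegral.continuous_parametric_intervalIntegral_of_continuous' hΨc 0 t
  have heq : ∀ η ∈ ({0}ᶜ : Set ℝ), energyForm a b (hθ.bdd.shift (y t)).toLinf (avg v η t) -
      energyForm a b (hθ.bdd.shift (y 0)).toLinf (avg v η 0) = ∫ s in (0 : ℝ)..t, Ψ η s := by
    intro η hη
    refine (intervalIntegral.integral_eq_sub_of_hasDerivAt
      (fun s _ => hasDerivAt_energyForm_avg ha hb hv hy hθ hθ2 hη s) ?_).symm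
    exact (hΨc.comp (by fun_prop : Continuous fun s => (η, s))).intervalIntegrable _ _
  -- Two continuous functions of `η` agreeing off `0` agree at `0`.
  have h0 := congr_fun (Continuous.ext_on (dense_compl_singleton (0 : ℝ)) hW hI heq) 0
  simp only [hΨ, avg_zero] at h0
  rw [h0]
  refine intervalIntegral.integral_congr fun s _ => ?_
  -- At `η = 0` the forcing is the nonlinearity of `v s` itself, so its exact-derivative structure
  -- is available.
  have h1 := (hθ.shift (y s)).tri_nonlin (v s).fst (v s).snd
  rw [hθ.toLinf_deriv_shift] at h1
  simp only [hn]
  rw [sub_eq_add_neg _ (tri (hθ.bdd.shift (y s)).toLinf _ _), h1, neg_neg]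

end Balance

/-! ### Weighted estimates -/

/-- Young's inequality with parameter `c`. The factor `2 k` fits both `κ = ρ` (`k = 1/2`) and `κ =
ρ'` for a slowly varying weight (`k = ν`). -/
lemma IsBdd.abs_tri_le {κ ρ : ℝ → ℝ} (hκ : IsBdd κ) (hρ : IsBdd ρ) {k c : ℝ}
    (hc : 0 < c) (h : ∀ x, |κ x| ≤ 2 * k * ρ x) (f g : L2) :
    |tri hκ.toLinf f g| ≤ k * (c * tri hρ.toLinf f f + c⁻¹ * tri hρ.toLinf g g) := by
  rw [hκ.tri_eq, hρ.tri_eq, hρ.tri_eq, ← integral_const_mul, ← integral_const_mul,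
    ← integral_add ((hρ.integrable f f).const_mul c) ((hρ.integrable g g).const_mul _),
    ← integral_const_mul]
  refine abs_integral_le_integral_abs.trans (integral_mono (hκ.integrable f g).abs
    ((((hρ.integrable f f).const_mul c).add ((hρ.integrable g g).const_mul _)).const_mul k) ?_)
  intro x
  simp only
  rw [mul_assoc, abs_mul, abs_mul]
  have h1 : 2 * (|f x| * |g x|) ≤ c * f x ^ 2 + c⁻¹ * g x ^ 2 := by
    have h2 : 0 ≤ c⁻¹ * (c * |f x| - |g x|) ^ 2 := by positivity
    have h3 : c⁻¹ * (c * |f x| - |g x|) ^ 2 =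
        c * f x ^ 2 + c⁻¹ * g x ^ 2 - 2 * (|f x| * |g x|) := by
      rw [← sq_abs (f x), ← sq_abs (g x)]; field_simp; ring
    linarith
  have h4 : 0 ≤ k * ρ x := by linarith [(abs_nonneg (κ x)).trans (h x)]
  calc |κ x| * (|f x| * |g x|) ≤ 2 * k * ρ x * (|f x| * |g x|) :=
        mul_le_mul_of_nonneg_right (h x) (by positivity)
    _ = k * ρ x * (2 * (|f x| * |g x|)) := by ring
    _ ≤ k * ρ x * (c * f x ^ 2 + c⁻¹ * g x ^ 2) := mul_le_mul_of_nonneg_left h1 h4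
    _ = _ := by ring

lemma IsBdd.tri_self_nonneg {ρ : ℝ → ℝ} (hρ : IsBdd ρ) (h : ∀ x, 0 ≤ ρ x) (f : L2) :
    0 ≤ tri hρ.toLinf f f := by
  rw [hρ.tri_eq]
  refine integral_nonneg fun x => ?_
  rw [mul_assoc]
  exact mul_nonneg (h x) (mul_self_nonneg _)

section Elliptic

variable {ρ : ℝ → ℝ} (hρ : IsWeight ρ) (h0 : ∀ x, 0 ≤ ρ x) {ν : ℝ} (hν : 0 < ν)
  (hder : ∀ x, |deriv ρ x| ≤ 2 * ν * ρ x)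

include h0

lemma IsWeight.abs_tri_le {c : ℝ} (hc : 0 < c) (f g : L2) :
    |tri hρ.bdd.toLinf f g| ≤
      1 / 2 * (c * tri hρ.bdd.toLinf f f + c⁻¹ * tri hρ.bdd.toLinf g g) :=
  hρ.bdd.abs_tri_le hρ.bdd hc
    (fun x => by rw [abs_of_nonneg (h0 x)]; linarith) f g

include hν hder

/-- Young with `c = ν` makes the commutator term cost `b ν² M²` plus exactly the available `b M'²`.
-/
lemma IsWeight.helmholtzInv_val_le {b : ℝ} (hb : 0 < b) (f : L2) :
    (1 - 2 * b * ν ^ 2) *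
        tri hρ.bdd.toLinf (val (helmholtzInv hb f)) (val (helmholtzInv hb f)) ≤
      tri hρ.bdd.toLinf f f := by
  have h1 := hρ.helmholtz_identity hb f
  have h2 := (abs_le.1 (hρ.bdd_deriv.abs_tri_le hρ.bdd hν hder
    (val (helmholtzInv hb f)) (der (helmholtzInv hb f)))).1
  have h3 := (abs_le.1 (hρ.abs_tri_le h0 one_pos (val (helmholtzInv hb f)) f)).2
  rw [mul_add, ← mul_assoc ν ν⁻¹, mul_inv_cancel₀ hν.ne'] at h2
  have h4 := mul_le_mul_of_nonneg_left h2 hb.le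
  rw [inv_one] at h3
  linarith

/-- Here `c = 2ν`, so the commutator uses only half of `b M'²` and the other half remains. -/
lemma IsWeight.helmholtzInv_der_le {b : ℝ} (hb : 0 < b) (hbν : 4 * b * ν ^ 2 ≤ 1) (f : L2) :
    b * tri hρ.bdd.toLinf (der (helmholtzInv hb f)) (der (helmholtzInv hb f)) ≤
      tri hρ.bdd.toLinf f f := by
  have h1 := hρ.helmholtz_identity hb f
  have h2 := (abs_le.1 (hρ.bdd_deriv.abs_tri_le hρ.bdd (mul_pos two_pos hν) hder
    (val (helmholtzInv hb f)) (der (helmholtzInv hb f)))).1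
  have h3 := (abs_le.1 (hρ.abs_tri_le h0 one_pos (val (helmholtzInv hb f)) f)).2
  have h5 := hρ.bdd.tri_self_nonneg h0 (val (helmholtzInv hb f))
  have hc : ν * (2 * ν)⁻¹ = 1 / 2 := by field_simp
  rw [mul_add, ← mul_assoc ν (2 * ν)⁻¹, hc] at h2
  have h4 := mul_le_mul_of_nonneg_left h2 hb.le
  rw [inv_one] at h3
  have h6 := mul_nonneg (sub_nonneg.2 hbν) h5
  linarith

end Elliptic

lemma IsWeight.tri_nonlin_self_le {ρ : ℝ → ℝ} (hρ : IsWeight ρ) (h0 : ∀ x, 0 ≤ ρ x) {ε : ℝ}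
    (hε : 0 < ε) {q r : H1} (hq : ‖q‖ ≤ ε) (hr : ‖r‖ ≤ ε) :
    tri hρ.bdd.toLinf (nonlin q r) (nonlin q r) ≤ 8 * ε ^ 2 *
      (tri hρ.bdd.toLinf (der q) (der q) + tri hρ.bdd.toLinf (der r) (der r)) := by
  rw [hρ.bdd.tri_eq, hρ.bdd.tri_eq, hρ.bdd.tri_eq,
    ← integral_add (hρ.bdd.integrable _ _) (hρ.bdd.integrable _ _), ← integral_const_mul]
  refine integral_mono_ae (hρ.bdd.integrable _ _)
    (((hρ.bdd.integrable _ _).add (hρ.bdd.integrable _ _)).const_mul _) ?_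
  filter_upwards [coeFn_nonlin q r, ae_abs_val_le_norm q, ae_abs_val_le_norm r] with x h1 h2 h3
  rw [h1]
  have h4 : val q x ^ 2 ≤ ε ^ 2 := sq_le_sq' (by linarith [(abs_le.1 h2).1])
    (by linarith [(abs_le.1 h2).2])
  have h5 : val r x ^ 2 ≤ ε ^ 2 := sq_le_sq' (by linarith [(abs_le.1 h3).1])
    (by linarith [(abs_le.1 h3).2])
  have h6 := mul_le_mul_of_nonneg_right h4 (sq_nonneg (der r x))
  have h7 := mul_le_mul_of_nonneg_right h5 (sq_nonneg (der q x))
  have h8 : (val r x * der q x + 2 * val q x * der r x) ^ 2 ≤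
      8 * ε ^ 2 * (der q x ^ 2 + der r x ^ 2) := by
    have h9 := sq_nonneg (val r x * der q x - 2 * val q x * der r x)
    have h10 : 0 ≤ ε ^ 2 * der q x ^ 2 := by positivity
    linarith
  calc _ = ρ x * (val r x * der q x + 2 * val q x * der r x) ^ 2 := by ring
    _ ≤ ρ x * (8 * ε ^ 2 * (der q x ^ 2 + der r x ^ 2)) := mul_le_mul_of_nonneg_left h8 (h0 x)
    _ = _ := by ring

lemma IsWeight.tri_cubic_le {ρ : ℝ → ℝ} (hρ : IsWeight ρ) (h0 : ∀ x, 0 ≤ ρ x) {ε : ℝ}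
    {q : H1} (hq : ‖q‖ ≤ ε) (f : L2) :
    tri hρ.bdd.toLinf f (mulL (sup q) f) ≤ ε * tri hρ.bdd.toLinf f f := by
  rw [hρ.bdd.tri_eq, hρ.bdd.tri_eq, ← integral_const_mul]
  refine integral_mono_ae (hρ.bdd.integrable _ _) ((hρ.bdd.integrable _ _).const_mul _) ?_
  filter_upwards [coeFn_mulL (sup q) f, coeFn_sup q, ae_abs_val_le_norm q] with x h1 h2 h3
  rw [h1, h2]
  have h4 : val q x ≤ ε := by linarith [(abs_le.1 h3).2]
  have h5 : 0 ≤ ρ x * f x ^ 2 := mul_nonneg (h0 x) (sq_nonneg _)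
  linarith [mul_le_mul_of_nonneg_right h4 h5]

lemma norm_fst_le (u : State) : ‖u.fst‖ ≤ ‖u‖ := by
  have := WithLp.prod_norm_sq_eq_of_L2 u
  exact abs_le_of_sq_le_sq' (by nlinarith [sq_nonneg ‖u.snd‖]) (norm_nonneg _) |>.2

lemma norm_snd_le (u : State) : ‖u.snd‖ ≤ ‖u‖ := by
  have := WithLp.prod_norm_sq_eq_of_L2 u
  exact abs_le_of_sq_le_sq' (by nlinarith [sq_nonneg ‖u.fst‖]) (norm_nonneg _) |>.2

lemma energyForm_nonneg {a b : ℝ} (ha : 0 ≤ a) (hb : 0 ≤ b) {ρ : ℝ → ℝ} (hρ : IsBdd ρ)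
    (h0 : ∀ x, 0 ≤ ρ x) (u : State) : 0 ≤ energyForm a b hρ.toLinf u := by
  have h := fun f => hρ.tri_self_nonneg h0 f
  have h1 := h (val u.fst)
  have h2 := h (val u.snd)
  have h3 := mul_nonneg ha (h (der u.fst))
  have h4 := mul_nonneg hb (h (der u.snd))
  rw [energyForm]
  linarith

/-- The flux of a small state through a slowly varying weight moves with speed at most `1 + 2 σ`. -/
lemma IsWeight.flux_le {a b : ℝ} (ha : 0 < a) (hab : a < b) (hb : 0 < b) {ρ : ℝ → ℝ}
    (hρ : IsWeight ρ) (h0 : ∀ x, 0 ≤ ρ x) {ν : ℝ} (hν : 0 < ν)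
    (hder : ∀ x, |deriv ρ x| ≤ 2 * ν * ρ x) {σ ε : ℝ} (hσ : 0 < σ) (hε : 0 < ε)
    (hν1 : 4 * b * ν ^ 2 ≤ 1) (hν2 : (1 + σ) * (2 * b * ν ^ 2) ≤ σ)
    (hεσ : (b + 2 + 8 / a + 8 / b) * ε ≤ σ) {u : State} (hu : ‖u‖ ≤ ε) :
    -fluxForm a hb hρ.bdd.toLinf u (nonlin u.fst u.snd) +
        tri hρ.bdd.toLinf (val u.snd) (mulL (sup u.fst) (val u.snd)) ≤
      (1 + 2 * σ) * energyForm a b hρ.bdd.toLinf u := by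
  have hqε := (norm_fst_le u).trans hu
  have hrε := (norm_snd_le u).trans hu
  set q : H1 := u.fst
  set r : H1 := u.snd
  set N := nonlin q r
  set m := hρ.bdd.toLinf
  have hX := fun f => hρ.bdd.tri_self_nonneg h0 f
  set S := val (helmholtzInv hb (val q))
  set M' := der (helmholtzInv hb N)
  have e1 := hρ.helmholtzInv_val_le h0 hν hder hb (val q)
  have e2 := hρ.helmholtzInv_der_le h0 hν hder hb hν1 N
  have e3 := hρ.tri_nonlin_self_le h0 hε hqε hrε
  have e4 := hρ.tri_cubic_le h0 hqε (val r)
  have b1 := (abs_le.1 (hρ.abs_tri_le h0 one_pos (val q) (val r))).1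
  have b2 := (abs_le.1 (hρ.abs_tri_le h0 one_pos (der q) (der r))).1
  have b3 := (abs_le.1 (hρ.abs_tri_le h0 one_pos (val r) S)).1
  have b4 := (abs_le.1 (hρ.abs_tri_le h0 hε (val r) M')).2
  -- The condition on `ν` says `(1 + σ)(1 - 2bν²) ≥ 1`.
  have hS : tri m S S ≤ (1 + σ) * tri m (val q) (val q) := by
    have h1 := mul_le_mul_of_nonneg_left e1 (by positivity : 0 ≤ 1 + σ)
    have h2 := mul_nonneg (sub_nonneg.2 hν2) (hX S)
    linarith
  -- The coefficients `a / b` and `1 - a / b` are nonnegative with sum `1`: this produces the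
  -- limiting speed `1`.
  have hflux : fluxForm a hb m u N = a / b * tri m (val q) (val r) + a * tri m (der q) (der r) -
      b * tri m (val r) M' + (1 - a / b) * tri m (val r) S := by
    rw [fluxForm, val_potentialDer, tri_add_right, tri_smul_right, tri_smul_right, tri_sub_right,
      tri_comm m (val u.snd) (val q), sub_div, div_self hb.ne']
    ring
  have hab0 : 0 ≤ a / b := by positivity
  have hab1 : 0 ≤ 1 - a / b := by rw [sub_nonneg, div_le_one hb]; exact hab.le
  rw [inv_one] at b1 b2 b3
  have c1 := mul_le_mul_of_nonneg_left b1 hab0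
  have c2 := mul_le_mul_of_nonneg_left b2 ha.le
  have c3 := mul_le_mul_of_nonneg_left b3 hab1
  have c3' := mul_le_mul_of_nonneg_left hS hab1
  have c2' : a * tri m (der r) (der r) ≤ b * tri m (der r) (der r) :=
    mul_le_mul_of_nonneg_right hab.le (hX _)
  -- The weighted square of `M'` is of order `ε²`, so Young with parameter `ε` leaves a term of
  -- order `ε`.
  have hN : ε⁻¹ * (b * tri m M' M') ≤
      8 * ε * (tri m (der q) (der q) + tri m (der r) (der r)) := by
    refine (mul_le_mul_of_nonneg_left (e2.trans e3) (by positivity)).trans_eq ?_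
    simp only [m]
    field_simp
  have c4 := mul_le_mul_of_nonneg_left b4 hb.le
  set L := energyForm a b m u with hL
  have hLdef : L = 1 / 2 * (tri m (val q) (val q) + tri m (val r) (val r) +
    a * tri m (der q) (der q) + b * tri m (der r) (der r)) := rfl
  have p1 := hX (val q)
  have p2 := hX (val r)
  have p3 := mul_nonneg ha.le (hX (der q))
  have p4 := mul_nonneg hb.le (hX (der r))
  have l1 : tri m (val r) (val r) ≤ 2 * L := by linarith
  have l2 : tri m (der q) (der q) ≤ 2 / a * L := by
    rw [div_mul_eq_mul_div, le_div_iff₀ ha]; linarith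
  have l3 : tri m (der r) (der r) ≤ 2 / b * L := by
    rw [div_mul_eq_mul_div, le_div_iff₀ hb]; linarith
  have hL0 : 0 ≤ L := by linarith
  have d1 : (b / 2 + 1) * ε * tri m (val r) (val r) ≤ (b / 2 + 1) * ε * (2 * L) :=
    mul_le_mul_of_nonneg_left l1 (by positivity)
  have d2 : 4 * ε * tri m (der q) (der q) ≤ 4 * ε * (2 / a * L) :=
    mul_le_mul_of_nonneg_left l2 (by positivity)
  have d3 : 4 * ε * tri m (der r) (der r) ≤ 4 * ε * (2 / b * L) :=
    mul_le_mul_of_nonneg_left l3 (by positivity)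
  have d4 := mul_le_mul_of_nonneg_right hεσ hL0
  have d5 : (b / 2 + 1) * ε * (2 * L) + 4 * ε * (2 / a * L) + 4 * ε * (2 / b * L) =
      (b + 2 + 8 / a + 8 / b) * ε * L := by ring
  have f1 : -fluxForm a hb m u N ≤ (1 + σ) * L + b / 2 * ε * tri m (val r) (val r) +
      4 * ε * (tri m (der q) (der q) + tri m (der r) (der r)) := by
    have g1 := mul_nonneg hσ.le p2
    have g2 := mul_nonneg hσ.le p3
    have g3 := mul_nonneg hσ.le p4
    have g4 := mul_nonneg hab0 (mul_nonneg hσ.le p1)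
    rw [hflux, hLdef]
    linarith
  linarith

/-! ### Conservation of energy -/

lemma isBdd_const (c : ℝ) : IsBdd fun _ => c := ⟨continuous_const, |c|, fun _ => le_rfl⟩

lemma isWeight_one : IsWeight fun _ => (1 : ℝ) :=
  ⟨contDiff_const, isBdd_const 1, by simpa using isBdd_const 0⟩

lemma tri_one (f : L2) : tri (isBdd_const 1).toLinf f f = ‖f‖ ^ 2 := by
  rw [IsBdd.tri_eq, ← real_inner_self_eq_norm_sq, inner_eq_integral]
  simp

lemma toLinf_eq_smul {θ ρ : ℝ → ℝ} (hθ : IsBdd θ) (hρ : IsBdd ρ) {c : ℝ}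
    (h : ∀ x, θ x = c * ρ x) : hθ.toLinf = c • hρ.toLinf := by
  ext1
  filter_upwards [hθ.coeFn_toLinf, hρ.coeFn_toLinf, Lp.coeFn_smul c hρ.toLinf] with x h1 h2 h3
  rw [h1, h3, Pi.smul_apply, h2, h, smul_eq_mul]

lemma energyForm_smul (a b c : ℝ) (m : Linf) (u : State) :
    energyForm a b (c • m) u = c * energyForm a b m u := by
  simp only [energyForm, tri_smul_weight]; ring

lemma fluxForm_smul (a : ℝ) {b : ℝ} (hb : 0 < b) (c : ℝ) (m : Linf) (u : State) (n : L2) :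
    fluxForm a hb (c • m) u n = c * fluxForm a hb m u n := by
  simp only [fluxForm, tri_smul_weight]; ring

/-- Apply the balance law with `θ = 1`, where `θ' = 0` annihilates the right-hand side. -/
lemma IsSolution.energy_conservation {a b : ℝ} (ha : a ≠ 0) (hb : 0 < b) {v : ℝ → State}
    (hv : IsSolution a b v) (t : ℝ) :
    energyForm a b (isBdd_const 1).toLinf (v t) = energyForm a b (isBdd_const 1).toLinf (v 0) := by
  have h2 : IsBdd (deriv (deriv fun _ : ℝ => (1 : ℝ))) := by simpa using isBdd_const 0
  have h := energyForm_balance ha hb hv (y := fun _ => 0) contDiff_const isWeight_one h2 t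
  have h0 : (isWeight_one.bdd_deriv.shift 0).toLinf = (0 : ℝ) • (isBdd_const 1).toLinf :=
    toLinf_eq_smul _ _ (by simp)
  simp only [h0, energyForm_smul, fluxForm_smul, tri_smul_weight] at h
  simp only [zero_mul, mul_zero, sub_zero, add_zero, intervalIntegral.integral_zero] at h
  exact sub_eq_zero.1 h

lemma energyForm_one (a b : ℝ) (u : State) : energyForm a b (isBdd_const 1).toLinf u =
    1 / 2 * (‖val u.fst‖ ^ 2 + ‖val u.snd‖ ^ 2 + a * ‖der u.fst‖ ^ 2 + b * ‖der u.snd‖ ^ 2) := by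
  simp only [energyForm, tri_one]

lemma norm_sq_state (u : State) : ‖u‖ ^ 2 =
    ‖val u.fst‖ ^ 2 + ‖val u.snd‖ ^ 2 + ‖der u.fst‖ ^ 2 + ‖der u.snd‖ ^ 2 := by
  rw [WithLp.prod_norm_sq_eq_of_L2, norm_sq_H1, norm_sq_H1]; ring

lemma IsSolution.norm_sq_le {a b : ℝ} (ha : 0 < a) (hab : a < b) {v : ℝ → State}
    (hv : IsSolution a b v) (t : ℝ) :
    min 1 a * ‖v t‖ ^ 2 ≤ max 1 b * ‖v 0‖ ^ 2 := by
  have h := hv.energy_conservation ha.ne' (ha.trans hab) t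
  rw [energyForm_one, energyForm_one] at h
  have lo : ∀ u : State, min 1 a * ‖u‖ ^ 2 ≤ ‖val u.fst‖ ^ 2 + ‖val u.snd‖ ^ 2 +
      a * ‖der u.fst‖ ^ 2 + b * ‖der u.snd‖ ^ 2 := by
    intro u
    rw [norm_sq_state]
    have h1 := mul_le_mul_of_nonneg_right (min_le_left 1 a) (sq_nonneg ‖val u.fst‖)
    have h2 := mul_le_mul_of_nonneg_right (min_le_left 1 a) (sq_nonneg ‖val u.snd‖)
    have h3 := mul_le_mul_of_nonneg_right (min_le_right 1 a) (sq_nonneg ‖der u.fst‖)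
    have h4 := mul_le_mul_of_nonneg_right ((min_le_right 1 a).trans hab.le)
      (sq_nonneg ‖der u.snd‖)
    linarith
  have hi : ∀ u : State, ‖val u.fst‖ ^ 2 + ‖val u.snd‖ ^ 2 +
      a * ‖der u.fst‖ ^ 2 + b * ‖der u.snd‖ ^ 2 ≤ max 1 b * ‖u‖ ^ 2 := by
    intro u
    rw [norm_sq_state]
    have h1 := mul_le_mul_of_nonneg_right (le_max_left 1 b) (sq_nonneg ‖val u.fst‖)
    have h2 := mul_le_mul_of_nonneg_right (le_max_left 1 b) (sq_nonneg ‖val u.snd‖)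
    have h3 := mul_le_mul_of_nonneg_right (hab.le.trans (le_max_right 1 b))
      (sq_nonneg ‖der u.fst‖)
    have h4 := mul_le_mul_of_nonneg_right (le_max_right 1 b) (sq_nonneg ‖der u.snd‖)
    linarith
  linarith [lo (v t), hi (v 0)]

/-! ### The hyperbolic weights -/

lemma hasDerivAt_tanh (x : ℝ) : HasDerivAt Real.tanh ((Real.cosh x)⁻¹ ^ 2) x := by
  have h := (Real.hasDerivAt_sinh x).div (Real.hasDerivAt_cosh x) (Real.cosh_pos x).ne'
  have e : Real.sinh / Real.cosh = Real.tanh := by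
    ext x; rw [Pi.div_apply, Real.tanh_eq_sinh_div_cosh]
  rw [e] at h
  refine h.congr_deriv ?_
  have h1 := Real.cosh_sq x
  have h2 := (Real.cosh_pos x).ne'
  field_simp
  linarith

lemma hasDerivAt_chi (ν x : ℝ) : HasDerivAt (chi ν) (ν * psi ν x ^ 2) x := by
  have h := ((hasDerivAt_tanh (ν * x)).comp x ((hasDerivAt_id x).const_mul ν)).const_add 1
  refine h.congr_deriv ?_
  rw [psi]; ring

lemma deriv_chi (ν : ℝ) : deriv (chi ν) = fun x => ν * psi ν x ^ 2 :=
  funext fun x => (hasDerivAt_chi ν x).deriv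

lemma psi_pos (ν x : ℝ) : 0 < psi ν x := inv_pos.2 (Real.cosh_pos _)

lemma psi_le_one (ν x : ℝ) : psi ν x ≤ 1 := inv_le_one_of_one_le₀ (Real.one_le_cosh _)

lemma psi_sq_le_one (ν x : ℝ) : psi ν x ^ 2 ≤ 1 :=
  pow_le_one₀ (psi_pos ν x).le (psi_le_one ν x)

lemma contDiff_psi (ν : ℝ) : ContDiff ℝ ∞ (psi ν) :=
  (Real.contDiff_cosh.comp (contDiff_const.mul contDiff_id)).inv fun _ => (Real.cosh_pos _).ne'

lemma hasDerivAt_psi_sq (ν x : ℝ) :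
    HasDerivAt (fun x => psi ν x ^ 2) (-(2 * ν * Real.tanh (ν * x)) * psi ν x ^ 2) x := by
  have h1 : HasDerivAt (fun x => Real.cosh (ν * x)) (Real.sinh (ν * x) * (ν * 1)) x :=
    ((hasDerivAt_id x).const_mul ν).cosh
  have h := (h1.fun_inv (Real.cosh_pos _).ne').fun_pow 2
  refine h.congr_deriv ?_
  have := (Real.cosh_pos (ν * x)).ne'
  rw [psi, Real.tanh_eq_sinh_div_cosh]
  simp only [Nat.cast_ofNat, Nat.add_one_sub_one, pow_one]
  field_simp

/-- The logarithmic derivative of `ψ²` is `-2ν tanh(νx)`; this is the slow variation required of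
`ρ`. -/
lemma abs_deriv_psi_sq_le {ν : ℝ} (hν : 0 < ν) (x : ℝ) :
    |deriv (fun x => psi ν x ^ 2) x| ≤ 2 * ν * psi ν x ^ 2 := by
  rw [(hasDerivAt_psi_sq ν x).deriv, abs_mul, abs_neg, abs_mul,
    abs_of_pos (mul_pos two_pos hν), abs_of_nonneg (sq_nonneg (psi ν x))]
  refine mul_le_mul_of_nonneg_right ?_ (sq_nonneg _)
  exact mul_le_of_le_one_right (by positivity) (Real.abs_tanh_lt_one _).le

lemma isWeight_psi_sq {ν : ℝ} (hν : 0 < ν) : IsWeight fun x => psi ν x ^ 2 := by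
  have hs : ContDiff ℝ ∞ fun x => psi ν x ^ 2 := (contDiff_psi ν).pow 2
  refine ⟨hs, ⟨hs.continuous, 1, fun x => ?_⟩,
    ⟨((contDiff_infty_iff_deriv (𝕜 := ℝ)).1 hs).2.continuous, 2 * ν * 1, fun x => ?_⟩⟩
  · rw [abs_of_nonneg (sq_nonneg _)]; exact psi_sq_le_one ν x
  · exact (abs_deriv_psi_sq_le hν x).trans
      (mul_le_mul_of_nonneg_left (psi_sq_le_one ν x) (by positivity))

lemma IsBdd.const_mul {θ : ℝ → ℝ} (h : IsBdd θ) (c : ℝ) : IsBdd fun x => c * θ x := by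
  obtain ⟨C, hC⟩ := h.2
  refine ⟨h.1.const_mul c, |c| * C, fun x => ?_⟩
  rw [abs_mul]
  exact mul_le_mul_of_nonneg_left (hC x) (abs_nonneg c)

lemma isWeight_chi {ν : ℝ} (hν : 0 < ν) : IsWeight (chi ν) := by
  have hd : Differentiable ℝ (chi ν) := fun x => (hasDerivAt_chi ν x).differentiableAt
  refine ⟨contDiff_infty_iff_deriv.2 ⟨hd, ?_⟩, ⟨hd.continuous, 2, fun x => ?_⟩, ?_⟩
  · rw [deriv_chi]
    exact contDiff_const.mul ((contDiff_psi ν).pow 2)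
  · have := abs_lt.1 (Real.abs_tanh_lt_one (ν * x))
    rw [chi, abs_le]
    constructor <;> linarith
  · rw [deriv_chi]
    exact (isWeight_psi_sq hν).bdd.const_mul ν

lemma isBdd_deriv_deriv_chi {ν : ℝ} (hν : 0 < ν) : IsBdd (deriv (deriv (chi ν))) := by
  have : deriv (deriv (chi ν)) = fun x => ν * deriv (fun x => psi ν x ^ 2) x := by
    rw [deriv_chi]
    ext x
    exact deriv_const_mul ν (hasDerivAt_psi_sq ν x).differentiableAt
  rw [this]
  exact (isWeight_psi_sq hν).bdd_deriv.const_mul ν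

lemma energyForm_eq_integral (a b : ℝ) {θ : ℝ → ℝ} (h : IsBdd θ) (u : State) :
    energyForm a b h.toLinf u = ∫ x, θ x * energyDensity a b u x := by
  have i1 := h.integrable (val u.fst) (val u.fst)
  have i2 := h.integrable (val u.snd) (val u.snd)
  have i3 := (h.integrable (der u.fst) (der u.fst)).const_mul a
  have i4 := (h.integrable (der u.snd) (der u.snd)).const_mul b
  rw [energyForm, h.tri_eq, h.tri_eq, h.tri_eq, h.tri_eq, ← integral_const_mul,
    ← integral_const_mul, ← integral_add i1 i2, ← integral_add (by exact i1.add i2) i3,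
    ← integral_add (by exact (i1.add i2).add i3) i4, ← integral_const_mul]
  congr 1
  ext x
  have e1 : val u.fst = u.q := rfl
  have e2 : val u.snd = u.r := rfl
  have e3 : der u.fst = u.qx := rfl
  have e4 : der u.snd = u.rx := rfl
  simp only [energyDensity, e1, e2, e3, e4]
  ring

lemma continuous_energyForm (a b : ℝ) {m : ℝ → Linf} (hm : Continuous m) {u : ℝ → State}
    (hu : Continuous u) : Continuous fun s => energyForm a b (m s) (u s) := by
  unfold energyForm; fun_prop

lemma continuous_fluxForm (a : ℝ) {b : ℝ} (hb : 0 < b) {m : ℝ → Linf} (hm : Continuous m)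
    {u : ℝ → State} (hu : Continuous u) {n : ℝ → L2} (hn : Continuous n) :
    Continuous fun s => fluxForm a hb (m s) (u s) (n s) := by
  unfold fluxForm
  simp only [val_potentialDer]
  fun_prop

/-- Almost monotonicity of the weighted energy of a uniformly small solution. -/
lemma IsSolution.weightedEnergy_add_le {a b : ℝ} (ha : 0 < a) (hab : a < b) {v : ℝ → State}
    (hv : IsSolution a b v) {ν σ ε c₁ : ℝ} (hν : 0 < ν) (hσ : 0 < σ) (hε : 0 < ε)
    (hν1 : 4 * b * ν ^ 2 ≤ 1) (hν2 : (1 + σ) * (2 * b * ν ^ 2) ≤ σ)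
    (hεσ : (b + 2 + 8 / a + 8 / b) * ε ≤ σ) (hc : 1 + 4 * σ ≤ c₁)
    {y : ℝ → ℝ} (hy : ContDiff ℝ 1 y) (hyc : ∀ t, c₁ ≤ deriv y t) (hsmall : ∀ s, ‖v s‖ ≤ ε)
    {t : ℝ} (ht : 0 ≤ t) :
    weightedEnergy a b ν (y t) (v t) +
        2 * σ * ν * ∫ s in (0 : ℝ)..t, localEnergy a b ν (y s) (v s) ≤
      weightedEnergy a b ν (y 0) (v 0) := by
  have hb := ha.trans hab
  have hψ := isWeight_psi_sq hν
  have hχ := isWeight_chi hν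
  have hbal := energyForm_balance ha.ne' hb hv hy hχ (isBdd_deriv_deriv_chi hν) t
  have hW : ∀ s, energyForm a b (hχ.bdd.shift (y s)).toLinf (v s) =
      weightedEnergy a b ν (y s) (v s) := fun s => energyForm_eq_integral a b _ _
  have hE : ∀ s, energyForm a b (hψ.bdd.shift (y s)).toLinf (v s) =
      localEnergy a b ν (y s) (v s) := fun s => energyForm_eq_integral a b _ _
  have hR : ∀ s, (hχ.bdd_deriv.shift (y s)).toLinf = ν • (hψ.bdd.shift (y s)).toLinf := fun s =>
    toLinf_eq_smul _ _ fun x => by rw [deriv_chi]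
  have hm : Continuous fun s => (hψ.bdd.shift (y s)).toLinf :=
    (continuous_toLinf_shift hψ.bdd (hψ.smooth.differentiable (by simp)) hψ.bdd_deriv).comp
      hy.continuous
  rw [hW, hW] at hbal
  simp only [hR, energyForm_smul, fluxForm_smul, tri_smul_weight] at hbal
  have hvc := hv.continuous
  have hyd : Continuous (deriv y) := hy.continuous_deriv (by simp)
  have hEc := continuous_energyForm a b hm hvc
  have hFc := continuous_fluxForm a hb hm hvc (continuous_nonlin hvc)
  have hle : ∀ s, -(deriv y s) * (ν * energyForm a b (hψ.bdd.shift (y s)).toLinf (v s)) -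
        ν * fluxForm a hb (hψ.bdd.shift (y s)).toLinf (v s) (nonlin (v s).fst (v s).snd) +
        ν * tri (hψ.bdd.shift (y s)).toLinf (val (v s).snd)
          (mulL (sup (v s).fst) (val (v s).snd)) ≤
      -(2 * σ * ν) * energyForm a b (hψ.bdd.shift (y s)).toLinf (v s) := by
    intro s
    have h0 : ∀ x, 0 ≤ psi ν (x - y s) ^ 2 := fun x => sq_nonneg _
    have hf := (hψ.shift (y s)).flux_le ha hab hb h0 hν (fun x => by
      rw [deriv_shift (fun x => psi ν x ^ 2)]; exact abs_deriv_psi_sq_le hν _)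
      hσ hε hν1 hν2 hεσ (hsmall s)
    have hpos := energyForm_nonneg ha.le hb.le (hψ.bdd.shift (y s)) h0 (v s)
    have h1 := mul_le_mul_of_nonneg_left hf hν.le
    -- The weight moves at speed at least `1 + 4σ` and the flux at most at `1 + 2σ`; the difference
    -- `2σ` is the dissipation rate.
    have h2 := mul_nonneg (sub_nonneg.2 (hc.trans (hyc s))) (mul_nonneg hν.le hpos)
    linarith
  have hint := intervalIntegral.integral_mono (μ := volume) ht
    (Continuous.intervalIntegrable (by fun_prop) 0 t)
    (Continuous.intervalIntegrable (by fun_prop) 0 t) hle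
  rw [intervalIntegral.integral_const_mul, ← hbal] at hint
  simp only [hE] at hint
  linarith

end BenneyLuke

end

theorem lemma10p1 (a b : ℝ) (ha : 0 < a) (hab : a < b) (c₁ : ℝ) (hc₁ : 1 < c₁) :
    ∃ ν₀ δ₄ μ : ℝ, 0 < ν₀ ∧ 0 < δ₄ ∧ 0 < μ ∧
      ∀ ν ∈ Set.Ioo 0 ν₀,
      ∀ xt : ℝ → ℝ, ContDiff ℝ 1 xt → (∀ t, c₁ ≤ deriv xt t) →
      ∀ v : ℝ → BenneyLuke.State, BenneyLuke.IsSolution a b v → ‖v 0‖ < δ₄ →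
      ∀ t : ℝ, 0 ≤ t →
        BenneyLuke.weightedEnergy a b ν (xt t) (v t) +
            μ * ν * ∫ s in (0 : ℝ)..t, BenneyLuke.localEnergy a b ν (xt s) (v s) ≤
          BenneyLuke.weightedEnergy a b ν (xt 0) (v 0) := by
  have hb := ha.trans hab
  -- A quarter of the speed margin, so that `1 + 4σ = c₁`.
  obtain ⟨σ, hσ⟩ : ∃ σ, σ = (c₁ - 1) / 4 := ⟨_, rfl⟩
  have hσ0 : 0 < σ := by rw [hσ]; linarith
  obtain ⟨C, hC⟩ : ∃ C, C = b + 2 + 8 / a + 8 / b := ⟨_, rfl⟩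
  have hC0 : 0 < C := by rw [hC]; positivity
  have hm : 0 < min 1 a := lt_min one_pos ha
  have hM : 0 < max 1 b := lt_max_of_lt_left one_pos
  have hκ : 0 < min (σ / (1 + σ)) (1 / 2) := lt_min (by positivity) (by norm_num)
  -- In `ν₀`, the entry `σ / (1 + σ)` controls `B⁻¹` and `1 / 2` gives `4bν² ≤ 1`. In `δ₄`, `σ / C`
  -- is the smallness needed at all times, and the square root is the loss from comparing the energy
  -- with the norm.
  refine ⟨Real.sqrt (min (σ / (1 + σ)) (1 / 2) / (2 * b)),
    σ / C * Real.sqrt (min 1 a / max 1 b), 2 * σ, by positivity, by positivity, by positivity, ?_⟩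
  intro ν hν y hy hyc v hv hv0 t ht
  have hν2 : 2 * b * ν ^ 2 < min (σ / (1 + σ)) (1 / 2) := by
    have h := (Real.lt_sqrt hν.1.le).1 hν.2
    rw [lt_div_iff₀ (by positivity)] at h
    linarith
  refine hv.weightedEnergy_add_le ha hab hν.1 hσ0 (div_pos hσ0 hC0) ?_ ?_ ?_ (c₁ := c₁) ?_ hy hyc
    (fun s => ?_) ht
  · linarith [hν2.trans_le (min_le_right _ _)]
  · have h := hν2.trans_le (min_le_left _ _)
    rw [lt_div_iff₀ (by positivity)] at h
    linarith
  · rw [← hC, mul_div_cancel₀ _ hC0.ne']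
  · rw [hσ]; linarith
  · have h1 := hv.norm_sq_le ha hab s
    have h2 : ‖v 0‖ ^ 2 ≤ (σ / C) ^ 2 * (min 1 a / max 1 b) := by
      have h3 := pow_le_pow_left₀ (norm_nonneg _) hv0.le 2
      rwa [mul_pow, Real.sq_sqrt (by positivity)] at h3
    have h4 : max 1 b * ‖v 0‖ ^ 2 ≤ min 1 a * (σ / C) ^ 2 := by
      refine (mul_le_mul_of_nonneg_left h2 hM.le).trans_eq ?_
      field_simp
    exact abs_le_of_sq_le_sq' (le_of_mul_le_mul_left (h1.trans h4) hm) (by positivity) |>.2
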